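/- **Theorem (Correctness of SolveMdp1).** Let $M=(\mathcal S,\mathcal A,p,r,\gamma)$ be an infinite-horizon discounted Markov decision process with finite state set $\mathcal S$, finite non-empty action set $\mathcal A$, rewards $r[s,a]\in[0,1]$ and discount $\gamma\in[0,1)$. Put $S=|\mathcal S|$, $A=|\mathcal A|$, $\Gamma=(1-\gamma)^{-1}$. For a policy $\pi:\mathcal S\to\mathcal A$ let $q^\pi[s,a]=\mathbb E[\sum_{t\ge 0}\gamma^t r[s_t,a_t]]$, where $s_0=s$, $a_0=a$, $s_{i+1}\sim p(\cdot|s_i,a_i)$ for $i\ge 0$ and $a_i=\pi[s_i]$ for $i\ge 1$; let $v^\pi[s]=q^\pi[s,\pi[s]]$, $v^*[s]=\max_\pi v^\pi[s]$ and $q^*[s,a]=\max_\pi q^\pi[s,a]$. Write $(Pu)[s,a]=\sum_{s'}p(s'|s,a)u[s']$. For $q\in\mathbb R^{\mathcal S\times\mathcal A}$ let $v(q)[s]=\max_a q[s,a]$ and $\pi(q)[s]\in\arg\max_a q[s,a]$. Inequalities and maxima of vectors are entrywise. *Access to $p$.* Transitions are accessed through a quantum generative model: a unitary $\mathcal O$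 on $\mathbb C^{\mathcal S}\otimes\mathbb C^{\mathcal A}\otimes\mathbb C^{\mathcal S}\otimes\mathbb C^J$ with $$\mathcal O|s\rangle|a\rangle|0\rangle|0\rangle=|s\rangle|a\rangle\sum_{s'}\sqrt{p(s'|s,a)}\,|s'\rangle|\psi_{s',s,a}\rangle$$ for unit vectors $\psi_{s',s,a}$, where $J\ge1$ and the $\psi_{s',s,a}$ are arbitrary. *Quantum mean estimation.* For $w:\mathcal S\to[0,1]$ and $t\ge1$ let $\mathrm{AE}_t(w)$ be the output of amplitude estimation with a grid of size $t$ for $\mu=(Pw)[s,a]$: apply $\mathcal O$ to $|s,a,0,0\rangle$ and rotate an extra qubit $|0\rangle$ to $\sqrt{1-w[s']}|0\rangle+\sqrt{w[s']}|1\rangle$; run phase estimation on the Grover operator of this unitary (good states: extra qubit equal to $1$) with a quantum Fourier transform on $\mathbb Z/t$; on outcome $y$ output $\sin^2(\pi y/t)$. For $f\in(0,1)$, *powering with parameter $f$* means taking the median of $2\lceil 9\ln(1/f)\rceil+1$ independent runs. - $\mathsf{qEst1}_f((Pv)[s,a],e;u)$ is $u$ times $\mathrm{AE}_t(v/u)$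 powered with parameter $f$, where $t=\lceil 8(u/e+\sqrt{u/e})\rceil+1$ ($v/u$ is truncated to $[0,1]$; the intended use is $0\le v\le u$). - $\mathsf{qEst2}_f((Pv)[s,a],e;\sigma)$ is the following procedure powered with parameter $f$. Measure the third register of $\mathcal O|s,a,0,0\rangle$, obtaining $s_0$; put $\eta=e/(4\sigma)$, $z=(v-v[s_0])/(4\sigma)$, and output $v[s_0]+4\sigma(m_+-m_-)$, where $m_\pm$ are independent estimates of the means of $z_+=\max\{z,0\}$ and $z_-=\max\{-z,0\}$ obtained as follows. Let $k=\lceil\log_2(8/\eta)\rceil$ and $t=\lceil 64\sqrt{k+1}/\eta\rceil+1$. For $0\le l\le k$ let $w_l$ be the function that equals $z_\pm/2^l$ where $2^{l-1}\le z_\pm<2^l$ (where $0\le z_\pm<1$ if $l=0$) and $0$ elsewhere. Then $m_\pm=\sum_{l=0}^k2^l\mu_l$, where $\mu_l$ is $\mathrm{AE}_t(w_l)$ powered with parameter $1/(10(k+1))$. (The intended use is $\mathrm{Var}_{s'\sim p(\cdot|s,a)}(v[s'])\le\sigma^2$ and $0<e<4\sigma$.) *The algorithm* $\mathsf{SolveMdp1}(M,\epsilon,\delta)$.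 Let $K=\lceil\log_2(\Gamma/\epsilon)\rceil$, $L=\lceil\Gamma\lceil\ln(4\Gamma/\epsilon)\rceil\rceil+1$, $f=\delta/(4KLSA)$, $b=1$, $c=0.01$. Start from $v_{1,0}=0$, $q_{1,0}=0$ and an arbitrary policy $\pi_{1,0}$. For $k=1,\dots,K$, with $\epsilon_k=\Gamma/2^k$, and with all estimations using fresh independent randomness: 1. for all $(s,a)$ set $y_k[s,a]=\max\{\mathsf{qEst1}_f((Pv_{k,0}^2)[s,a],b;\Gamma^2)-(\mathsf{qEst1}_f((Pv_{k,0})[s,a],(1-\gamma)b;\Gamma))^2,\,0\}$, $e_k[s,a]=c(1-\gamma)^{1.5}\epsilon\sqrt{y_k[s,a]+b}$ and $x_k[s,a]=\mathsf{qEst2}_f((Pv_{k,0})[s,a],e_k[s,a];\sqrt{y_k[s,a]+4b})-e_k[s,a]$; 2. for $l=1,\dots,L$: for each $s$, if $v(q_{k,l-1})[s]\ge v_{k,l-1}[s]$, set $v_{k,l}[s]=v(q_{k,l-1})[s]$ and $\pi_{k,l}[s]=\pi(q_{k,l-1})[s]$, otherwise $v_{k,l}[s]=v_{k,l-1}[s]$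 and $\pi_{k,l}[s]=\pi_{k,l-1}[s]$; then for all $(s,a)$ set $\Delta_{k,l}[s,a]=\mathsf{qEst1}_f((P(v_{k,l}-v_{k,0}))[s,a],c(1-\gamma)\epsilon_k;2\epsilon_k)-c(1-\gamma)\epsilon_k$, and $q_{k,l}=\max\{r+\gamma(x_k+\Delta_{k,l}),0\}$; 3. set $(v_{k+1,0},\pi_{k+1,0},q_{k+1,0})=(v_{k,L},\pi_{k,L},q_{k,L})$. The output $(\hat v,\hat\pi,\hat q)$ is $(v_{K,L},\pi_{K,L},q_{K,L})$ (the initial values if $K=0$). *Claim.* For every $\epsilon\in(0,\sqrt\Gamma]$ and $\delta\in(0,1)$, every quantum generative model $\mathcal O$ of $M$ and every initial policy $\pi_{1,0}$, with probability at least $1-\delta$ the output of $\mathsf{SolveMdp1}$ satisfies $$v^*-\epsilon\le\hat v\le v^{\hat\pi}\le v^*\qquad\text{and}\qquad q^*-\epsilon\le\hat q\le q^{\hat\pi}\le q^*.$$ -/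

import Mathlib

open MeasureTheory ProbabilityTheory Matrix
open scoped Kronecker

namespace QuantumMDP

noncomputable section

/-! ## Markov decision processes -/

/-- A finite infinite-horizon discounted Markov decision process `(S, A, p, r, γ)`; `p s a` is the
distribution `p(· | s, a)` of the next state. -/
structure MDP (S A : Type*) where
  p : S → A → PMF S
  r : S → A → ℝ
  γ : ℝ
  r_nonneg : ∀ s a, 0 ≤ r s a
  r_le_one : ∀ s a, r s a ≤ 1
  γ_nonneg : 0 ≤ γ
  γ_lt_one : γ < 1

section Values

variable {S A : Type*} [Fintype S] [Fintype A]

/-- The effective time horizon `Γ = (1 - γ)⁻¹`. -/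
def horizon (γ : ℝ) : ℝ := (1 - γ)⁻¹

/-- The kernel on state-action pairs that moves from `(s, a)` to `(s', π s')`, `s' ∼ p(· | s, a)`.
The finite set `S × A` carries the discrete σ-algebra. -/
def MDP.stepKernel (M : MDP S A) (π : S → A) : @Kernel (S × A) (S × A) ⊤ ⊤ :=
  letI : MeasurableSpace (S × A) := ⊤
  Kernel.ofFunOfCountable fun x => ((M.p x.1 x.2).map fun s' => (s', π s')).toMeasure

instance MDP.isMarkovKernel_stepKernel (M : MDP S A) (π : S → A) :
    @IsMarkovKernel (S × A) (S × A) ⊤ ⊤ (M.stepKernel π) := by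
  let _ : MeasurableSpace (S × A) := ⊤
  exact ⟨fun x => by
    change IsProbabilityMeasure ((M.p x.1 x.2).map fun s' => (s', π s')).toMeasure
    infer_instance⟩

/-- The law of the trajectory `(s₀, a₀), (s₁, a₁), …` with `s₀ = s`, `a₀ = a`,
`s_{i+1} ∼ p(· | s_i, a_i)` and `a_i = π s_i` for all `i ≥ 1`. -/
def MDP.trajectory (M : MDP S A) (π : S → A) (s : S) (a : A) :
    @Measure (ℕ → S × A) (@MeasurableSpace.pi ℕ (fun _ => S × A) fun _ => ⊤) :=
  letI : MeasurableSpace (S × A) := ⊤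
  haveI : IsMarkovKernel (M.stepKernel π) := M.isMarkovKernel_stepKernel π
  Kernel.trajMeasure (X := fun _ => S × A) (Measure.dirac (s, a)) fun n =>
    (M.stepKernel π).comap (fun h : (i : Finset.Iic n) → S × A => h ⟨n, Finset.mem_Iic.2 le_rfl⟩)
      (measurable_pi_apply _)

/-- The Q-function `q^π[s, a]`: the expected discounted sum of rewards when action `a` is taken in
the initial state `s` and the policy `π` is followed afterwards. -/
def MDP.qValue (M : MDP S A) (π : S → A) (s : S) (a : A) : ℝ :=
  letI : MeasurableSpace (S × A) := ⊤
  ∫ ω, ∑' t : ℕ, M.γ ^ t * M.r (ω t).1 (ω t).2 ∂(M.trajectory π s a)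

/-- The value `v^π[s]`: the same expectation when `π` is followed from the start. -/
def MDP.value (M : MDP S A) (π : S → A) (s : S) : ℝ := M.qValue π s (π s)

/-- The optimal value `v*[s]`, the best value over the (finitely many) policies `S → A`. Any policy
`π*` that is optimal in every state has `v^{π*} = v*`. -/
def MDP.optValue (M : MDP S A) (s : S) : ℝ := ⨆ π : S → A, M.value π s

/-- The optimal Q-value `q*[s, a]`. -/
def MDP.optQValue (M : MDP S A) (s : S) (a : A) : ℝ := ⨆ π : S → A, M.qValue π s a

end Values

/-! ## Discrete probability -/

/-- Independent draws from `μ 0, …, μ (n - 1)`. -/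
def indepFin {α : Type*} : (n : ℕ) → (Fin n → PMF α) → PMF (Fin n → α)
  | 0, _ => PMF.pure Fin.elim0
  | n + 1, μ => (μ 0).bind fun a => (indepFin n fun i => μ i.succ).map fun x => Fin.cons a x

/-- Independent draws from the distributions `μ i`, `i` in a finite type. -/
def indep {ι α : Type*} [Fintype ι] (μ : ι → PMF α) : PMF (ι → α) :=
  (indepFin (Fintype.card ι) fun i => μ ((Fintype.equivFin ι).symm i)).map
    fun x i => x (Fintype.equivFin ι i)

/-- The median of an odd number of reals. -/
def median {m : ℕ} (x : Fin (2 * m + 1) → ℝ) : ℝ := x (Tuple.sort x ⟨m, by omega⟩)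

/-- The median of `O(log (1 / f))` independent runs: if one run succeeds with probability more than
`2 / 3`, this boosts the success probability to more than `1 - f`. -/
def powering (f : ℝ) (μ : PMF ℝ) : PMF ℝ :=
  (indepFin (2 * ⌈9 * Real.log (1 / f)⌉₊ + 1) fun _ => μ).map median

/-! ## Quantum circuits -/

section Circuits

variable {X : Type*} [Fintype X] [DecidableEq X]

/-- Sign flip `|x⟩ ↦ -|x⟩` on the basis states outside `good`. -/
def signMatrix (good : X → Prop) [DecidablePred good] : unitaryGroup X ℂ :=
  ⟨diagonal fun x => if good x then 1 else -1, by
    rw [mem_unitaryGroup_iff, star_eq_conjTranspose, diagonal_conjTranspose, diagonal_mul_diagonal,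
      ← diagonal_one]
    congr 1
    funext x
    by_cases h : good x <;> simp [h]⟩

/-- The quantum Fourier transform, `|j⟩ ↦ t^{-1/2} ∑ₖ exp(2πijk/t) |k⟩`. -/
def qftMatrix (t : ℕ) : Matrix (Fin t) (Fin t) ℂ :=
  of fun k j => (Real.sqrt t : ℂ)⁻¹ *
    Complex.exp (2 * Real.pi * Complex.I * ((j : ℕ) : ℂ) * ((k : ℕ) : ℂ) / (t : ℂ))

theorem qftMatrix_mem (t : ℕ) [NeZero t] : qftMatrix t ∈ unitaryGroup (Fin t) ℂ := by
  have ht : (t : ℂ) ≠ 0 := Nat.cast_ne_zero.2 (NeZero.ne t)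
  have hs : (√(t : ℝ) : ℂ)⁻¹ * (√(t : ℝ) : ℂ)⁻¹ = (t : ℂ)⁻¹ := by
    rw [← mul_inv, ← Complex.ofReal_mul, Real.mul_self_sqrt (Nat.cast_nonneg t),
      Complex.ofReal_natCast]
  rw [mem_unitaryGroup_iff, star_eq_conjTranspose]
  ext k l
  rw [Matrix.mul_apply]
  set ζ : ℂ := Complex.exp (2 * Real.pi * Complex.I * (((k : ℕ) : ℂ) - ((l : ℕ) : ℂ)) / t) with hζ
  have hterm : ∀ j : Fin t, qftMatrix t k j * (qftMatrix t)ᴴ j l = (t : ℂ)⁻¹ * ζ ^ (j : ℕ) := by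
    intro j
    simp only [qftMatrix, conjTranspose_apply, of_apply, star_mul', Complex.star_def, map_inv₀,
      Complex.conj_ofReal, ← Complex.exp_conj, map_div₀, map_mul, Complex.conj_I, map_natCast,
      map_ofNat]
    rw [mul_mul_mul_comm, hs, ← Complex.exp_add, hζ, ← Complex.exp_nat_mul]
    congr 2
    ring
  rw [Finset.sum_congr rfl fun j _ => hterm j, ← Finset.mul_sum,
    Fin.sum_univ_eq_sum_range fun j => ζ ^ j]
  by_cases hkl : k = l
  · subst hkl
    simp [hζ, ht]
  · have hζ1 : ζ ≠ 1 := by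
      intro h
      obtain ⟨n, hn⟩ := Complex.exp_eq_one_iff.1 h
      have h2 : (((k : ℕ) : ℂ) - ((l : ℕ) : ℂ)) = n * t := by
        have hpi : (2 * Real.pi * Complex.I : ℂ) ≠ 0 := Complex.two_pi_I_ne_zero
        field_simp at hn
        linear_combination hn
      have h3 : ((k : ℕ) : ℤ) - ((l : ℕ) : ℤ) = n * t := by exact_mod_cast h2
      have hk := k.2
      have hl := l.2
      have h4 : ((k : ℕ) : ℤ) - ((l : ℕ) : ℤ) = 0 :=
        Int.eq_zero_of_abs_lt_dvd (m := (t : ℤ)) ⟨n, by rw [h3]; ring⟩ (by rw [abs_lt]; omega)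
      exact hkl (Fin.ext (by omega))
    have hζt : ζ ^ t = 1 := by
      rw [hζ, ← Complex.exp_nat_mul, Complex.exp_eq_one_iff]
      refine ⟨((k : ℕ) : ℤ) - ((l : ℕ) : ℤ), ?_⟩
      push_cast
      field_simp
    rw [geom_sum_eq hζ1, hζt, one_apply_ne hkl]
    simp

/-- The quantum Fourier transform as a unitary. -/
def qft (t : ℕ) [NeZero t] : unitaryGroup (Fin t) ℂ := ⟨qftMatrix t, qftMatrix_mem t⟩

/-- The block diagonal unitary `|x⟩ ⊗ |k⟩ ↦ (U k |x⟩) ⊗ |k⟩`, i.e. `U k` controlled by `k`. -/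
def controlled {Y : Type*} [Fintype Y] [DecidableEq Y] (U : Y → unitaryGroup X ℂ) :
    unitaryGroup (X × Y) ℂ :=
  ⟨blockDiagonal fun k => (U k : Matrix X X ℂ), by
    rw [mem_unitaryGroup_iff, star_eq_conjTranspose, blockDiagonal_conjTranspose,
      ← blockDiagonal_mul, ← blockDiagonal_one]
    congr 1
    funext k
    exact mem_unitaryGroup_iff.1 (U k).2⟩

/-- The unitary `U ⊗ V`. -/
def tensor {Y : Type*} [Fintype Y] [DecidableEq Y] (U : unitaryGroup X ℂ) (V : unitaryGroup Y ℂ) :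
    unitaryGroup (X × Y) ℂ :=
  ⟨(U : Matrix X X ℂ) ⊗ₖ (V : Matrix Y Y ℂ), kronecker_mem_unitary U.2 V.2⟩

theorem sum_born (U : unitaryGroup X ℂ) (x₀ : X) :
    ∑ x, ENNReal.ofReal (‖(U : Matrix X X ℂ) x x₀‖ ^ 2) = 1 := by
  rw [← ENNReal.ofReal_sum_of_nonneg fun _ _ => by positivity, ENNReal.ofReal_eq_one]
  have h := congrFun (congrFun (mem_unitaryGroup_iff'.1 U.2) x₀) x₀
  rw [star_eq_conjTranspose, Matrix.mul_apply, one_apply_eq] at h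
  simp only [conjTranspose_apply, Complex.star_def, Complex.conj_mul'] at h
  exact_mod_cast h

/-- The Born rule: the outcome of measuring `U |x₀⟩` in the computational basis. -/
def measureOutcome (U : unitaryGroup X ℂ) (x₀ : X) : PMF X :=
  PMF.ofFintype (fun x => ENNReal.ofReal (‖(U : Matrix X X ℂ) x x₀‖ ^ 2)) (sum_born U x₀)

/-- The amplification (Grover) operator `V (2|x₀⟩⟨x₀| - 1) V⁻¹ (1 - 2 Π)`, with `Π` the projection
onto the span of the good basis states. -/
def grover (V : unitaryGroup X ℂ) (x₀ : X) (good : X → Prop) [DecidablePred good] :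
    unitaryGroup X ℂ :=
  V * signMatrix (fun x => x = x₀) * V⁻¹ * signMatrix fun x => ¬ good x

/-- Amplitude estimation on a grid of size `t` for the probability that measuring `V |x₀⟩` gives a
good basis state: phase estimation of the amplification operator `Q` (Fourier transform of the
control register `|0⟩`, controlled powers of `Q` applied to `V |x₀⟩`, inverse Fourier transform,
measurement of the control register with outcome `y`), with output `sin² (π y / t)`. -/
def ampEst (V : unitaryGroup X ℂ) (x₀ : X) (good : X → Prop) [DecidablePred good]
    (t : ℕ) [NeZero t] : PMF ℝ :=
  (measureOutcome (tensor 1 (qft t)⁻¹ * controlled (fun j : Fin t => grover V x₀ good ^ (j : ℕ)) *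
      tensor V (qft t)) (x₀, (0 : Fin t))).map
    fun xy => Real.sin (Real.pi * (xy.2 : ℕ) / t) ^ 2

end Circuits

/-- The rotation `|0⟩ ↦ √(1-w) |0⟩ + √w |1⟩` of one qubit. -/
def qubitRotation (w : unitInterval) : unitaryGroup (Fin 2) ℂ :=
  ⟨!![(√(1 - w : ℝ) : ℂ), -(√(w : ℝ) : ℂ); (√(w : ℝ) : ℂ), (√(1 - w : ℝ) : ℂ)], by
    have h₁ : (√(1 - w : ℝ) : ℂ) * (√(1 - w : ℝ) : ℂ) = 1 - (w : ℝ) := by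
      rw [← Complex.ofReal_mul, Real.mul_self_sqrt (by linarith [w.2.2])]
      push_cast
      rfl
    have h₂ : (√(w : ℝ) : ℂ) * (√(w : ℝ) : ℂ) = (w : ℝ) := by
      rw [← Complex.ofReal_mul, Real.mul_self_sqrt w.2.1]
    rw [mem_unitaryGroup_iff, star_eq_conjTranspose]
    ext i j
    fin_cases i <;> fin_cases j <;>
      simp [Matrix.mul_apply, Fin.sum_univ_two, h₁, h₂, mul_comm]⟩

/-! ## Quantum access to a Markov decision process -/

section Oracle

variable {S A : Type*} [Fintype S] [DecidableEq S] [Fintype A] [DecidableEq A]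

/-- A unitary `U` on `ℂ^S ⊗ ℂ^A ⊗ ℂ^S ⊗ ℂ^J`, with the basis state of `ℂ^S` that is called `|0⟩`. -/
structure Oracle (S A : Type*) [Fintype S] [DecidableEq S] [Fintype A] [DecidableEq A] where
  J : ℕ
  [neZero : NeZero J]
  zero : S
  U : unitaryGroup (S × A × S × Fin J) ℂ

attribute [instance] Oracle.neZero

/-- `O` is a quantum generative model of `M`:
`|s⟩|a⟩|0⟩|0⟩ ↦ |s⟩|a⟩ ∑_{s'} √p(s'|s,a) |s'⟩|ψ_{s',s,a}⟩` for some states `ψ_{s',s,a}`. -/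
def Oracle.IsGenerativeModel (O : Oracle S A) (M : MDP S A) : Prop :=
  ∃ ψ : S → S → A → Fin O.J → ℂ, (∀ s' s a, ∑ j, ‖ψ s' s a j‖ ^ 2 = 1) ∧
    ∀ s a s₁ a₁ s' j, O.U.1 (s₁, a₁, s', j) (s, a, O.zero, 0) =
      if s₁ = s ∧ a₁ = a then (Real.sqrt (M.p s a s').toReal : ℂ) * ψ s' s a j else 0

/-- Prepare `|s⟩|a⟩|0⟩|0⟩`, apply the oracle once and measure the next state. -/
def Oracle.sample (O : Oracle S A) (s : S) (a : A) : PMF S :=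
  (measureOutcome O.U (s, a, O.zero, 0)).map fun x => x.2.2.1

/-- Amplitude estimation of `∑_{s'} p(s'|s,a) w[s']`: after the oracle, rotate an extra qubit by
`w[s']`; the good basis states are those where the extra qubit is `1`. -/
def Oracle.estAmp (O : Oracle S A) (s : S) (a : A) (w : S → unitInterval) (t : ℕ) [NeZero t] :
    PMF ℝ :=
  ampEst (controlled (fun x : S × A × S × Fin O.J => qubitRotation (w x.2.2.1)) * tensor 1 O.U)
    ((0 : Fin 2), (s, a, O.zero, 0)) (fun x => x.1 = 1) t

/-- Truncation of a real to `[0, 1]`. -/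
def clamp (x : ℝ) : unitInterval := Set.projIcc 0 1 zero_le_one x

/-- Quantum mean estimation with a range bound: under the promise `0 ≤ v ≤ u`, it returns the mean
of `v[s']`, `s' ∼ p(· | s, a)`, to error less than `e` with probability more than `1 - f`. -/
def qEst1 (O : Oracle S A) (s : S) (a : A) (v : S → ℝ) (u e f : ℝ) : PMF ℝ :=
  (powering f (O.estAmp s a (fun s' => clamp (v s' / u)) (⌈8 * (u / e + √(u / e))⌉₊ + 1))).map
    fun x => u * x

/-- The part of `z` with values in the `l`-th dyadic band (`[0, 1)` for `l = 0`, `[2^{l-1}, 2^l)`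
for `l ≥ 1`), divided by `2^l`. -/
def band (z : S → ℝ) (l : ℕ) (s' : S) : ℝ :=
  if (l = 0 ∨ (2 : ℝ) ^ l / 2 ≤ z s') ∧ z s' < 2 ^ l then z s' / 2 ^ l else 0

/-- Estimation of the mean of `z[s']`, `s' ∼ p(· | s, a)`, for `z ≥ 0` with second moment at most
`1`, to error less than `η / 2`, where `0 < η < 1`: amplitude estimation on dyadic bands. -/
def secondMomentEst (O : Oracle S A) (s : S) (a : A) (z : S → ℝ) (η : ℝ) : PMF ℝ :=
  let k := ⌈Real.logb 2 (8 / η)⌉₊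
  (indep fun l : Fin (k + 1) => powering (1 / (10 * (k + 1)))
      (O.estAmp s a (fun s' => clamp (band z l s')) (⌈64 * √(k + 1) / η⌉₊ + 1))).map
    fun x => ∑ l : Fin (k + 1), 2 ^ (l : ℕ) * x l

/-- One run of quantum mean estimation with a variance bound: subtract one sample from `v`, rescale
by `4σ`, and estimate the means of the positive and negative parts separately. -/
def qEst2Run (O : Oracle S A) (s : S) (a : A) (v : S → ℝ) (σ e : ℝ) : PMF ℝ :=
  (O.sample s a).bind fun s₀ =>
    (secondMomentEst O s a (fun s' => max ((v s' - v s₀) / (4 * σ)) 0) (e / (4 * σ))).bind fun x =>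
      (secondMomentEst O s a (fun s' => max (-((v s' - v s₀) / (4 * σ))) 0) (e / (4 * σ))).map
        fun y => v s₀ + 4 * σ * (x - y)

/-- Quantum mean estimation with a variance bound: under the promises that the variance of `v[s']`,
`s' ∼ p(· | s, a)`, is at most `σ²` and `0 < e < 4σ`, it returns the mean of `v[s']` to error less
than `e` with probability more than `1 - f`. -/
def qEst2 (O : Oracle S A) (s : S) (a : A) (v : S → ℝ) (σ e f : ℝ) : PMF ℝ :=
  powering f (qEst2Run O s a v σ e)

/-! ## The algorithm `SolveMdp1` -/

/-- The variables `v_{k,l}`, `π_{k,l}`, `q_{k,l}` of the algorithm. -/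
structure Sol (S A : Type*) where
  v : S → ℝ
  π : S → A
  q : S → A → ℝ

/-- Some maximizer of `x` (ties are broken arbitrarily). -/
def argmax [Nonempty A] (x : A → ℝ) : A := Classical.choose (Finite.exists_max x)

/-- `v(q)[s] = max_a q[s, a]`, attained at `π(q)[s] = argmax_a q[s, a]`. -/
def greedyValue [Nonempty A] (q : S → A → ℝ) (s : S) : ℝ := q s (argmax (q s))

/-- The number of epochs `K = ⌈log₂ (Γ / ε)⌉`. -/
def numEpochs (γ ε : ℝ) : ℕ := ⌈Real.logb 2 (horizon γ / ε)⌉₊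

/-- The epoch length `L = ⌈Γ ⌈ln (4 Γ / ε)⌉⌉ + 1`. -/
def epochLength (γ ε : ℝ) : ℕ := ⌈horizon γ * (⌈Real.log (4 * horizon γ / ε)⌉₊ : ℝ)⌉₊ + 1

/-- The failure probability `f = δ / (4 K L S A)` of each estimation. -/
def failProb (S A : Type*) [Fintype S] [Fintype A] (γ ε δ : ℝ) : ℝ :=
  δ / (4 * numEpochs γ ε * epochLength γ ε * Fintype.card S * Fintype.card A)

/-- The parameter `b`. -/
def paramB : ℝ := 1

/-- The parameter `c`. -/
def paramC : ℝ := 0.01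

/-- The accuracy `ε_k = Γ / 2^k` of epoch `k`. -/
def epochError (γ : ℝ) (k : ℕ) : ℝ := horizon γ / 2 ^ k

/-- The computation of `y_k[s, a]` and `x_k[s, a]` from `v_{k,0}`; the law of `x_k[s, a]`. -/
def anchor (O : Oracle S A) (γ ε f : ℝ) (v₀ : S → ℝ) (s : S) (a : A) : PMF ℝ :=
  (qEst1 O s a (fun s' => v₀ s' ^ 2) (horizon γ ^ 2) paramB f).bind fun m₂ =>
    (qEst1 O s a v₀ (horizon γ) ((1 - γ) * paramB) f).bind fun m₁ =>
      let y := max (m₂ - m₁ ^ 2) 0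
      let e := paramC * (1 - γ) ^ (3 / 2 : ℝ) * ε * √(y + paramB)
      (qEst2 O s a v₀ √(y + 4 * paramB) e f).map fun m => m - e

/-- Iteration `l` of epoch `k`, which started with `v₀ = v_{k,0}` and computed `x = x_k`. -/
def iteration [Nonempty A] (r : S → A → ℝ) (γ : ℝ) (O : Oracle S A) (f : ℝ) (k : ℕ)
    (v₀ : S → ℝ) (x : S × A → ℝ) (X : Sol S A) : PMF (Sol S A) :=
  let v := fun s => if X.v s ≤ greedyValue X.q s then greedyValue X.q s else X.v s
  let π := fun s => if X.v s ≤ greedyValue X.q s then argmax (X.q s) else X.π s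
  let e := paramC * (1 - γ) * epochError γ k
  (indep fun sa : S × A =>
      (qEst1 O sa.1 sa.2 (fun s' => v s' - v₀ s') (2 * epochError γ k) e f).map fun m => m - e).map
    fun Δ => ⟨v, π, fun s a => max (r s a + γ * (x (s, a) + Δ (s, a))) 0⟩

/-- `n` successive random steps, numbered `1, …, n`. -/
def loop {α : Type*} (step : ℕ → α → PMF α) : ℕ → α → PMF α
  | 0, X => PMF.pure X
  | n + 1, X => (loop step n X).bind (step (n + 1))

/-- Epoch `k`: compute `x_k`, then do `L` iterations. -/
def epoch [Nonempty A] (r : S → A → ℝ) (γ : ℝ) (O : Oracle S A) (ε f : ℝ) (k : ℕ)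
    (X : Sol S A) : PMF (Sol S A) :=
  (indep fun sa : S × A => anchor O γ ε f X.v sa.1 sa.2).bind fun x =>
    loop (fun _ => iteration r γ O f k X.v x) (epochLength γ ε) X

/-- The law of the output `(v̂, π̂, q̂)` of `SolveMdp1`, started with an arbitrary policy `π₀`. It
knows `r` and `γ`, and has access to the transition probabilities only through the oracle. -/
def solveMdp1 [Nonempty A] (r : S → A → ℝ) (γ : ℝ) (O : Oracle S A) (ε δ : ℝ) (π₀ : S → A) :
    PMF (Sol S A) :=
  loop (epoch r γ O ε (failProb S A γ ε δ)) (numEpochs γ ε) ⟨fun _ => 0, π₀, fun _ _ => 0⟩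

end Oracle

end

end QuantumMDP

open QuantumMDP

/-! Two facts combine: each estimation call rarely misses its accuracy, and value iteration fed with
such estimates climbs from below while its error halves in every epoch. `FailsLE` isolates the
probability: the union bounds `FailsLE.bind`, `failsLE_indep` and `failsLE_loop` reduce everything
else to deterministic invariants.

Estimation. On the plane spanned by the good and bad parts of V|x₀⟩ the Grover operator rotates by
2θ, where sin²θ = μ. Phase estimation therefore yields the average of two squared Dirichlet kernels,
centred at θ and -θ (`sum_ampEst_amplitude`). Each has weight at least 2/3 on the two grid points
around its centre, and sin² is even, so the error is at most 2√(μ(1-μ))π/t + (π/t)² with probability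
2/3 (`failsLE_ampEst`); medians amplify this. Under a variance bound, subtracting one sample
produces a bounded second moment, and dyadic bands exploit the factor √μ in the error, by
Cauchy–Schwarz (`sum_two_pow_mul_sqrt_le`).

One-sidedness. Estimates are shifted down, so they never exceed the true means. Hence v remains a
subsolution of the Bellman equation of its own policy and q stays below r + γPv; comparison
(`MDP.le_value`) gives v ≤ v^π and q ≤ q^π.

Accuracy. Let σ be greedy for q*. In an epoch entered with error B, the error of q after l
iterations is at most γ^l B + H, as soon as H ≥ γ(error of one step) + γP_σH. The step error is of
order (1-γ)^{3/2} ε √Var, and its accumulation is controlled by a potential: Ψ = 2Γ² - q*² satisfies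
Ψ ≥ γ² Var(v*) + γP_σΨ. Weighted AM–GM trades √Var for Var/√Γ + √Γ/2, so H can be built from Ψ and a
constant with H ≤ B/4 (`MDP.exists_error_potential`). Since γ^{L-1} ≤ 1/4, the epoch ends with error
at most B/2, and Γ/2^K ≤ ε. -/

namespace QuantumMDP

noncomputable section

/-! ## Homogeneous Markov chains on a finite set -/

section Chain

variable {X : Type*} [Finite X] [MeasurableSpace X] [DiscreteMeasurableSpace X]

/-- The law of the homogeneous Markov chain with kernel `κ` started in `x₀`. -/
def chain (κ : Kernel X X) [IsMarkovKernel κ] (x₀ : X) : Measure (ℕ → X) :=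
  Kernel.trajMeasure (X := fun _ => X) (Measure.dirac x₀) fun n =>
    κ.comap (fun h : (i : Finset.Iic n) → X => h ⟨n, Finset.mem_Iic.2 le_rfl⟩)
      (measurable_pi_apply _)

instance (κ : Kernel X X) [IsMarkovKernel κ] (x₀ : X) : IsProbabilityMeasure (chain κ x₀) := by
  unfold chain
  infer_instance

theorem integral_chain_zero (κ : Kernel X X) [IsMarkovKernel κ] (x₀ : X) (g : X → ℝ) :
    ∫ ω, g (ω 0) ∂(chain κ x₀) = g x₀ := by
  have h : (chain κ x₀).map (fun ω => ω 0) = Measure.dirac x₀ := by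
    have h1 : (fun ω : ℕ → X => ω 0) =
        (fun h : (i : Finset.Iic 0) → X => h ⟨0, Finset.mem_Iic.2 le_rfl⟩) ∘
          (Preorder.frestrictLe (π := fun _ => X) 0) := rfl
    rw [h1, ← Measure.map_map (by fun_prop) (by fun_prop), chain, Kernel.trajMeasure,
      Measure.map_comp _ _ (by fun_prop), Kernel.traj_map_frestrictLe, Kernel.partialTraj_self,
      Measure.id_comp, Measure.map_map (by fun_prop) (by fun_prop),
      Measure.map_dirac' (by fun_prop)]
    rfl
  calc ∫ ω, g (ω 0) ∂(chain κ x₀) = ∫ x, g x ∂((chain κ x₀).map (fun ω => ω 0)) := by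
        rw [integral_map (measurable_pi_apply 0).aemeasurable
          Measurable.of_discrete.aestronglyMeasurable]
    _ = g x₀ := by rw [h, integral_dirac]

/-- The joint law of the history up to time n and the next state is a composition-product whose
kernel reads only coordinate n of the history; Fubini then leaves an integral over ω n. -/
theorem integral_chain_succ (κ : Kernel X X) [IsMarkovKernel κ] (x₀ : X) (g : X → ℝ) (n : ℕ) :
    ∫ ω, g (ω (n + 1)) ∂(chain κ x₀) = ∫ ω, (∫ y, g y ∂(κ (ω n))) ∂(chain κ x₀) := by
  have hg : Measurable g := Measurable.of_discrete
  set κ' := κ.comap (fun h : (i : Finset.Iic n) → X => h ⟨n, Finset.mem_Iic.2 le_rfl⟩)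
      (measurable_pi_apply _) with hκ'
  have h := Kernel.map_frestrictLe_trajMeasure_compProd_eq_map_trajMeasure (X := fun _ => X)
    (μ₀ := Measure.dirac x₀) (a := n) (κ := fun n =>
    κ.comap (fun h : (i : Finset.Iic n) → X => h ⟨n, Finset.mem_Iic.2 le_rfl⟩)
      (measurable_pi_apply _))
  change (chain κ x₀).map _ ⊗ₘ κ' = (chain κ x₀).map _ at h
  have hm : Measurable (fun z : ((i : Finset.Iic n) → X) × X => g z.2) := hg.comp measurable_snd
  obtain ⟨C, hC⟩ := (Set.finite_range fun x => ‖g x‖).bddAbove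
  have hP : IsProbabilityMeasure ((chain κ x₀).map (Preorder.frestrictLe (π := fun _ => X) n)) :=
    Measure.isProbabilityMeasure_map (by fun_prop)
  calc ∫ ω, g (ω (n + 1)) ∂(chain κ x₀)
      = ∫ z, g z.2 ∂((chain κ x₀).map
          (fun ω => (Preorder.frestrictLe (π := fun _ => X) n ω, ω (n + 1)))) := by
        rw [integral_map (by fun_prop) hm.aestronglyMeasurable]
    _ = ∫ h, ∫ y, g y ∂(κ' h) ∂((chain κ x₀).map (Preorder.frestrictLe (π := fun _ => X) n)) := by
        rw [← h, Measure.integral_compProd]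
        refine Integrable.of_bound hm.aestronglyMeasurable C
          (Filter.Eventually.of_forall fun z => ?_)
        exact hC ⟨z.2, rfl⟩
    _ = _ := by
        rw [integral_map (by fun_prop)]
        · rfl
        · exact (Measurable.of_discrete (f := fun x => ∫ y, g y ∂(κ x))).comp
            (measurable_pi_apply _) |>.aestronglyMeasurable

/-- The expected discounted reward of a chain satisfies the Bellman equation. -/
theorem chain_bellman (κ : Kernel X X) [IsMarkovKernel κ] (r : X → ℝ) (γ : ℝ) (h0 : 0 ≤ γ)
    (h1 : γ < 1) (hr0 : ∀ x, 0 ≤ r x) (hr1 : ∀ x, r x ≤ 1) (x₀ : X) :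
    ∫ ω, ∑' t : ℕ, γ ^ t * r (ω t) ∂(chain κ x₀) =
      r x₀ + γ * ∫ y, ∫ ω, ∑' t : ℕ, γ ^ t * r (ω t) ∂(chain κ y) ∂(κ x₀) := by
  have hr : Measurable r := Measurable.of_discrete
  -- With the transition operator T, the value becomes the Neumann series ∑ γ^t T^t r, and the
  -- Bellman equation is the splitting off of its first term.
  set T : (X → ℝ) → X → ℝ := fun g x => ∫ y, g y ∂(κ x) with hT
  have hit : ∀ (n : ℕ) (g : X → ℝ) (x : X), ∫ ω, g (ω n) ∂(chain κ x) = T^[n] g x := by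
    intro n
    induction n with
    | zero => intro g x; exact integral_chain_zero κ x g
    | succ n ih =>
      intro g x
      rw [integral_chain_succ, Function.iterate_succ_apply]
      exact ih (T g) x
  have hint : ∀ (x : X) (t : ℕ), Integrable (fun ω => γ ^ t * r (ω t)) (chain κ x) := by
    intro x t
    refine Integrable.of_bound (Measurable.aestronglyMeasurable ?_) (γ ^ t)
      (Filter.Eventually.of_forall fun ω => ?_)
    · exact (hr.comp (measurable_pi_apply t)).const_mul _
    · rw [Real.norm_of_nonneg (mul_nonneg (pow_nonneg h0 _) (hr0 _))]
      exact mul_le_of_le_one_right (pow_nonneg h0 _) (hr1 _)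
  have hT01 : ∀ (n : ℕ) x, 0 ≤ T^[n] r x ∧ T^[n] r x ≤ 1 := by
    intro n x
    rw [← hit]
    constructor
    · exact integral_nonneg fun ω => hr0 _
    · calc ∫ ω, r (ω n) ∂(chain κ x) ≤ ∫ ω, (1 : ℝ) ∂(chain κ x) := by
            refine integral_mono_of_nonneg (Filter.Eventually.of_forall fun ω => hr0 _)
              (integrable_const _) (Filter.Eventually.of_forall fun ω => hr1 _)
        _ = 1 := by simp
  have hsumm : ∀ x, Summable fun t : ℕ => γ ^ t * T^[t] r x := fun x =>
    Summable.of_nonneg_of_le (fun t => mul_nonneg (pow_nonneg h0 _) (hT01 t x).1)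
      (fun t => mul_le_of_le_one_right (pow_nonneg h0 _) (hT01 t x).2)
      (summable_geometric_of_lt_one h0 h1)
  have hsum : ∀ x, ∫ ω, ∑' t : ℕ, γ ^ t * r (ω t) ∂(chain κ x) = ∑' t : ℕ, γ ^ t * T^[t] r x := by
    intro x
    rw [← integral_tsum_of_summable_integral_norm (hint x)]
    · refine tsum_congr fun t => ?_
      rw [integral_const_mul, hit]
    · refine (hsumm x).congr fun t => ?_
      rw [← hit, ← integral_const_mul]
      refine integral_congr_ae (Filter.Eventually.of_forall fun ω => ?_)
      exact (Real.norm_of_nonneg (mul_nonneg (pow_nonneg h0 _) (hr0 _))).symm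
  -- Applying T once more shifts the series by one index.
  have hmain : ∫ y, (∑' t : ℕ, γ ^ t * T^[t] r y) ∂(κ x₀) = ∑' t : ℕ, γ ^ t * T^[t + 1] r x₀ := by
    rw [← integral_tsum_of_summable_integral_norm fun t => Integrable.of_finite]
    · refine tsum_congr fun t => ?_
      rw [integral_const_mul, Function.iterate_succ_apply']
    · refine Summable.of_nonneg_of_le (fun t => integral_nonneg fun y => norm_nonneg _)
        (fun t => ?_) (summable_geometric_of_lt_one h0 h1)
      calc ∫ y, ‖γ ^ t * T^[t] r y‖ ∂(κ x₀) ≤ ∫ y, γ ^ t ∂(κ x₀) := by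
            refine integral_mono Integrable.of_finite (integrable_const _) fun y => ?_
            rw [Real.norm_of_nonneg (mul_nonneg (pow_nonneg h0 _) (hT01 t y).1)]
            exact mul_le_of_le_one_right (pow_nonneg h0 _) (hT01 t y).2
        _ = γ ^ t := by simp
  simp_rw [hsum]
  rw [hmain, (hsumm x₀).tsum_eq_zero_add, ← tsum_mul_left]
  congr 1
  · simp
  · refine tsum_congr fun t => ?_
    ring

omit [Finite X] [DiscreteMeasurableSpace X] in
theorem chain_value_bounds (κ : Kernel X X) [IsMarkovKernel κ] (r : X → ℝ) (γ : ℝ) (h0 : 0 ≤ γ)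
    (h1 : γ < 1) (hr0 : ∀ x, 0 ≤ r x) (hr1 : ∀ x, r x ≤ 1) (x₀ : X) :
    0 ≤ ∫ ω, ∑' t : ℕ, γ ^ t * r (ω t) ∂(chain κ x₀) ∧
      ∫ ω, ∑' t : ℕ, γ ^ t * r (ω t) ∂(chain κ x₀) ≤ (1 - γ)⁻¹ := by
  have hn : ∀ ω : ℕ → X, 0 ≤ ∑' t : ℕ, γ ^ t * r (ω t) := fun ω =>
    tsum_nonneg fun t => mul_nonneg (pow_nonneg h0 _) (hr0 _)
  refine ⟨integral_nonneg hn, ?_⟩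
  calc ∫ ω, ∑' t : ℕ, γ ^ t * r (ω t) ∂(chain κ x₀) ≤ ∫ ω, (1 - γ)⁻¹ ∂(chain κ x₀) := by
        refine integral_mono_of_nonneg (Filter.Eventually.of_forall hn)
          (integrable_const _) (Filter.Eventually.of_forall fun ω => ?_)
        have hle : ∀ t, γ ^ t * r (ω t) ≤ γ ^ t := fun t =>
          mul_le_of_le_one_right (pow_nonneg h0 _) (hr1 _)
        change _ ≤ (1 - γ)⁻¹
        rw [← tsum_geometric_of_lt_one h0 h1]
        exact Summable.tsum_le_tsum hle (Summable.of_nonneg_of_le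
          (fun t => mul_nonneg (pow_nonneg h0 _) (hr0 _)) hle (summable_geometric_of_lt_one h0 h1))
          (summable_geometric_of_lt_one h0 h1)
    _ = (1 - γ)⁻¹ := by simp

end Chain

/-! ## Bellman equations -/

section Bellman

variable {S A : Type*} [Fintype S]

/-- `(P u)[s, a] = ∑_{s'} p(s' | s, a) u[s']`. -/
def MDP.mean (M : MDP S A) (s : S) (a : A) (u : S → ℝ) : ℝ := ∑ s', (M.p s a s').toReal * u s'

variable (M : MDP S A)

theorem MDP.sum_p (s : S) (a : A) : ∑ s', (M.p s a s').toReal = 1 := by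
  rw [← ENNReal.toReal_sum fun s' _ => (M.p s a).apply_ne_top s',
    ← tsum_fintype (L := .unconditional S), PMF.tsum_coe, ENNReal.toReal_one]

omit [Fintype S] in
theorem MDP.one_le_horizon : 1 ≤ horizon M.γ :=
  (one_le_inv₀ (by linarith [M.γ_lt_one])).2 (by linarith [M.γ_nonneg])

variable {M}

theorem MDP.mean_mono {s : S} {a : A} {u w : S → ℝ} (h : ∀ s', u s' ≤ w s') :
    M.mean s a u ≤ M.mean s a w :=
  Finset.sum_le_sum fun s' _ => mul_le_mul_of_nonneg_left (h s') ENNReal.toReal_nonneg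

theorem MDP.mean_const (s : S) (a : A) (c : ℝ) : M.mean s a (fun _ => c) = c := by
  rw [MDP.mean, ← Finset.sum_mul, M.sum_p, one_mul]

theorem MDP.mean_add (s : S) (a : A) (u w : S → ℝ) :
    M.mean s a (fun s' => u s' + w s') = M.mean s a u + M.mean s a w := by
  simp only [MDP.mean, mul_add, Finset.sum_add_distrib]

theorem MDP.mean_sub (s : S) (a : A) (u w : S → ℝ) :
    M.mean s a (fun s' => u s' - w s') = M.mean s a u - M.mean s a w := by
  simp only [MDP.mean, mul_sub, Finset.sum_sub_distrib]

theorem MDP.mean_const_mul (s : S) (a : A) (c : ℝ) (u : S → ℝ) :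
    M.mean s a (fun s' => c * u s') = c * M.mean s a u := by
  simp only [MDP.mean, Finset.mul_sum]
  exact Finset.sum_congr rfl fun s' _ => by ring

theorem MDP.mean_sum {ι : Type*} (T : Finset ι) (s : S) (a : A) (u : ι → S → ℝ) :
    M.mean s a (fun s' => ∑ i ∈ T, u i s') = ∑ i ∈ T, M.mean s a (u i) := by
  simp only [MDP.mean, Finset.mul_sum]
  exact Finset.sum_comm

theorem MDP.mean_sq_sub (s : S) (a : A) (v : S → ℝ) (c : ℝ) :
    M.mean s a (fun s' => (v s' - c) ^ 2) =
      M.mean s a (fun s' => (v s' - M.mean s a v) ^ 2) + (M.mean s a v - c) ^ 2 := by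
  have h : ∀ d, M.mean s a (fun s' => (v s' - d) ^ 2) =
      M.mean s a (fun s' => v s' ^ 2) - 2 * d * M.mean s a v + d ^ 2 := by
    intro d
    have : (fun s' => (v s' - d) ^ 2) = fun s' => v s' ^ 2 - (2 * d) * v s' + d ^ 2 := by
      funext s'
      ring
    rw [this, MDP.mean_add, MDP.mean_sub, MDP.mean_const_mul, MDP.mean_const]
  rw [h, h]
  ring

theorem MDP.mean_nonneg {s : S} {a : A} {u : S → ℝ} (h : ∀ s', 0 ≤ u s') : 0 ≤ M.mean s a u :=
  Finset.sum_nonneg fun s' _ => mul_nonneg ENNReal.toReal_nonneg (h s')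

theorem MDP.mean_le {s : S} {a : A} {u : S → ℝ} {c : ℝ} (h : ∀ s', u s' ≤ c) :
    M.mean s a u ≤ c :=
  (M.mean_mono h).trans_eq (M.mean_const s a c)

variable (M) [Fintype A]

theorem MDP.qValue_bellman (π : S → A) (s : S) (a : A) :
    M.qValue π s a = M.r s a + M.γ * M.mean s a (M.value π) := by
  let _ : MeasurableSpace (S × A) := ⊤
  have : IsMarkovKernel (M.stepKernel π) := M.isMarkovKernel_stepKernel π
  have h := chain_bellman (M.stepKernel π) (fun x => M.r x.1 x.2) M.γ M.γ_nonneg M.γ_lt_one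
    (fun x => M.r_nonneg _ _) (fun x => M.r_le_one _ _) (s, a)
  have h2 : ∀ g : S × A → ℝ, ∫ y, g y ∂(M.stepKernel π (s, a)) =
      M.mean s a fun s' => g (s', π s') := by
    intro g
    let _ : MeasurableSpace S := ⊤
    change ∫ y, g y ∂((M.p s a).map fun s' => (s', π s')).toMeasure = _
    rw [← PMF.toMeasure_map _ _ Measurable.of_discrete,
      integral_map Measurable.of_discrete.aemeasurable Measurable.of_discrete.aestronglyMeasurable,
      PMF.integral_eq_sum]
    rfl
  rw [h2] at h
  exact h

theorem MDP.qValue_bounds (π : S → A) (s : S) (a : A) :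
    0 ≤ M.qValue π s a ∧ M.qValue π s a ≤ horizon M.γ := by
  let _ : MeasurableSpace (S × A) := ⊤
  have : IsMarkovKernel (M.stepKernel π) := M.isMarkovKernel_stepKernel π
  exact chain_value_bounds (M.stepKernel π) (fun x => M.r x.1 x.2) M.γ M.γ_nonneg M.γ_lt_one
    (fun x => M.r_nonneg _ _) (fun x => M.r_le_one _ _) (s, a)

theorem MDP.qValue_le_optQValue (π : S → A) (s : S) (a : A) :
    M.qValue π s a ≤ M.optQValue s a :=
  le_ciSup (f := fun π => M.qValue π s a) (Set.finite_range _).bddAbove π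

theorem MDP.value_le_optValue (π : S → A) (s : S) : M.value π s ≤ M.optValue s :=
  le_ciSup (f := fun π => M.value π s) (Set.finite_range _).bddAbove π

variable [Nonempty A]

theorem MDP.optQValue_nonneg (s : S) (a : A) : 0 ≤ M.optQValue s a := by
  obtain ⟨a₀⟩ := ‹Nonempty A›
  exact (M.qValue_bounds (fun _ => a₀) s a).1.trans (M.qValue_le_optQValue _ s a)

theorem MDP.optQValue_le_horizon (s : S) (a : A) : M.optQValue s a ≤ horizon M.γ :=
  ciSup_le fun π => (M.qValue_bounds π s a).2

theorem MDP.optValue_nonneg (s : S) : 0 ≤ M.optValue s := by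
  obtain ⟨a₀⟩ := ‹Nonempty A›
  exact (M.qValue_bounds _ s _).1.trans (M.value_le_optValue (fun _ => a₀) s)

theorem MDP.optValue_le_horizon (s : S) : M.optValue s ≤ horizon M.γ :=
  ciSup_le fun π => (M.qValue_bounds π s _).2

/-- Only this half of the Bellman optimality equation is needed; the converse would require one
policy that is optimal in all states. -/
theorem MDP.optQValue_le (s : S) (a : A) :
    M.optQValue s a ≤ M.r s a + M.γ * M.mean s a M.optValue := by
  refine ciSup_le fun π => ?_
  rw [M.qValue_bellman]
  have := mul_le_mul_of_nonneg_left
    (MDP.mean_mono (M := M) (s := s) (a := a) (M.value_le_optValue π)) M.γ_nonneg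
  linarith

/-- The greedy policy of q* plays the role of an optimal policy in the error analysis, without a
proof that it is one: v^π[s] = q^π[s, π s] ≤ q*[s, π s] ≤ q*[s, σ s]. -/
theorem MDP.exists_optValue_le : ∃ σ : S → A, ∀ s, M.optValue s ≤ M.optQValue s (σ s) := by
  have : ∀ s, ∃ a, M.optValue s ≤ M.optQValue s a := by
    intro s
    obtain ⟨a, ha⟩ := Finite.exists_max fun a => M.optQValue s a
    exact ⟨a, ciSup_le fun π => (M.qValue_le_optQValue π s (π s)).trans (ha _)⟩
  choose σ hσ using this
  exact ⟨σ, hσ⟩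

omit [Nonempty A] in
/-- A subsolution of the Bellman equation of a policy is a lower bound of its value. -/
theorem MDP.le_value {π : S → A} {v : S → ℝ}
    (h : ∀ s, v s ≤ M.r s (π s) + M.γ * M.mean s (π s) v) (s : S) : v s ≤ M.value π s := by
  have : Nonempty S := ⟨s⟩
  -- Maximum principle: at a maximiser the difference d = v - v^π satisfies d ≤ γd, hence d ≤ 0.
  obtain ⟨s₀, hs₀⟩ := Finite.exists_max fun s => v s - M.value π s
  have h1 : M.value π s₀ = M.r s₀ (π s₀) + M.γ * M.mean s₀ (π s₀) (M.value π) :=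
    M.qValue_bellman π s₀ (π s₀)
  have h2 := h s₀
  have h3 : M.mean s₀ (π s₀) (fun s => v s - M.value π s) ≤ v s₀ - M.value π s₀ :=
    MDP.mean_le hs₀
  rw [MDP.mean_sub] at h3
  have h4 := M.γ_nonneg
  have h5 := M.γ_lt_one
  have h6 := hs₀ s
  have h7 := mul_le_mul_of_nonneg_left h3 h4
  nlinarith

end Bellman

/-! ## Failure probabilities -/

section Failure

open scoped ENNReal

variable {α β : Type*}

/-- A draw from `μ` violates `G` with probability at most `x`. -/
def FailsLE (μ : PMF α) (G : α → Prop) (x : ℝ≥0∞) : Prop := μ.toOuterMeasure {a | ¬ G a} ≤ x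

theorem FailsLE.mono {μ : PMF α} {G H : α → Prop} {x y : ℝ≥0∞} (h : FailsLE μ G x)
    (hGH : ∀ a, G a → H a) (hxy : x ≤ y) : FailsLE μ H y :=
  (measure_mono (t := {a | ¬ G a}) fun a (ha : ¬ H a) (hG : G a) => ha (hGH a hG)).trans
    (h.trans hxy)

theorem toOuterMeasure_le_one (μ : PMF α) (s : Set α) : μ.toOuterMeasure s ≤ 1 :=
  (measure_mono (Set.subset_univ s)).trans_eq
    ((PMF.toOuterMeasure_apply_eq_one_iff _ _).2 (Set.subset_univ _))

theorem FailsLE.pure {a : α} {G : α → Prop} (h : G a) : FailsLE (PMF.pure a) G 0 := by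
  simp [FailsLE, PMF.toOuterMeasure_pure_apply, h]

theorem failsLE_map {μ : PMF α} {g : α → β} {G : β → Prop} {x : ℝ≥0∞} :
    FailsLE (μ.map g) G x ↔ FailsLE μ (fun a => G (g a)) x := by
  rw [FailsLE, PMF.toOuterMeasure_map_apply]
  rfl

/-- Total probability over the first draw: off G the second failure probability is bounded by 1, on
G by y. -/
theorem FailsLE.bind {μ : PMF α} {κ : α → PMF β} {G : α → Prop} {H : β → Prop} {x y : ℝ≥0∞}
    (hG : FailsLE μ G x) (hH : ∀ a, G a → FailsLE (κ a) H y) : FailsLE (μ.bind κ) H (x + y) := by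
  rw [FailsLE, PMF.toOuterMeasure_bind_apply]
  have h : ∀ a, μ a * (κ a).toOuterMeasure {b | ¬ H b} ≤ {a | ¬ G a}.indicator μ a + μ a * y := by
    intro a
    by_cases ha : G a
    · exact (mul_le_mul_right (hH a ha) _).trans le_add_self
    · rw [Set.indicator_of_mem (show a ∈ {a | ¬ G a} from ha)]
      refine le_add_right (mul_le_of_le_one_right' ?_)
      exact toOuterMeasure_le_one _ _
  calc _ ≤ ∑' a, ({a | ¬ G a}.indicator μ a + μ a * y) := ENNReal.tsum_le_tsum h
    _ = μ.toOuterMeasure {a | ¬ G a} + y := by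
        rw [ENNReal.tsum_add, ENNReal.tsum_mul_right, PMF.tsum_coe, one_mul,
          PMF.toOuterMeasure_apply]
    _ ≤ x + y := by gcongr; exact hG

theorem FailsLE.le_toOuterMeasure {μ : PMF α} {G : α → Prop} {δ : ℝ}
    (h : FailsLE μ G (ENNReal.ofReal δ)) (hδ : 0 ≤ δ) :
    ENNReal.ofReal (1 - δ) ≤ μ.toOuterMeasure {a | G a} := by
  rw [ENNReal.ofReal_sub _ hδ, ENNReal.ofReal_one, tsub_le_iff_right]
  have h1 : (1 : ℝ≥0∞) = μ.toOuterMeasure Set.univ :=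
    ((PMF.toOuterMeasure_apply_eq_one_iff _ _).2 (Set.subset_univ _)).symm
  rw [h1]
  refine (measure_mono (t := {a | G a} ∪ {a | ¬ G a}) fun a _ => em (G a)).trans
    ((measure_union_le _ _).trans (add_le_add le_rfl h))

theorem failsLE_of_le_toOuterMeasure {μ : PMF α} {G : α → Prop} {p q : ℝ≥0∞}
    (h : p ≤ μ.toOuterMeasure {a | G a}) (hpq : 1 ≤ p + q) (hp : p ≠ ⊤) : FailsLE μ G q := by
  have h1 : μ.toOuterMeasure {a | G a} + μ.toOuterMeasure {a | ¬ G a} = 1 := by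
    let _ : MeasurableSpace α := ⊤
    simp only [← PMF.toMeasure_apply_eq_toOuterMeasure]
    exact prob_add_prob_compl (μ := μ.toMeasure) (s := {a | G a}) trivial
  have h2 : p + μ.toOuterMeasure {a | ¬ G a} ≤ p + q :=
    ((add_le_add h le_rfl).trans_eq h1).trans hpq
  exact (ENNReal.add_le_add_iff_left hp).1 h2

theorem failsLE_indepFin : ∀ {n : ℕ} {μ : Fin n → PMF α} {G : Fin n → α → Prop} {x : Fin n → ℝ≥0∞},
    (∀ i, FailsLE (μ i) (G i) (x i)) → FailsLE (indepFin n μ) (fun a => ∀ i, G i (a i)) (∑ i, x i)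
  | 0, _, _, _, _ => by
    rw [Fin.sum_univ_zero]
    exact FailsLE.pure fun i => i.elim0
  | n + 1, μ, G, x, h => by
    rw [Fin.sum_univ_succ, indepFin]
    refine (h 0).bind fun a ha => failsLE_map.2 ?_
    exact (failsLE_indepFin fun i => h i.succ).mono (fun b hb => Fin.cases (by simpa using ha)
      (by simpa using hb)) le_rfl

theorem failsLE_indep {ι : Type*} [Fintype ι] {μ : ι → PMF α} {G : ι → α → Prop} {x : ℝ≥0∞}
    (h : ∀ i, FailsLE (μ i) (G i) x) :
    FailsLE (indep μ) (fun a => ∀ i, G i (a i)) (Fintype.card ι * x) := by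
  refine failsLE_map.2 ((failsLE_indepFin fun i => h ((Fintype.equivFin ι).symm i)).mono
    (fun a ha i => ?_) (by simp))
  simpa using ha (Fintype.equivFin ι i)

theorem failsLE_loop {step : ℕ → α → PMF α} {I : ℕ → α → Prop} {X : α} {x : ℝ≥0∞} (h0 : I 0 X) :
    ∀ {n : ℕ}, (∀ i < n, ∀ Y, I i Y → FailsLE (step (i + 1) Y) (I (i + 1)) x) →
      FailsLE (loop step n X) (I n) (n * x)
  | 0, _ => by
    rw [Nat.cast_zero, zero_mul]
    exact FailsLE.pure h0
  | n + 1, h => by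
    rw [Nat.cast_succ, add_mul, one_mul]
    exact (failsLE_loop h0 fun i hi => h i (hi.trans n.lt_succ_self)).bind (h n n.lt_succ_self)

end Failure

/-! ## Boosting by medians -/

section Median

open scoped ENNReal
open Classical in
/-- The number of entries of `x` that violate `G`. -/
def numBad {α : Type*} {n : ℕ} (G : α → Prop) (x : Fin n → α) : ℕ :=
  (Finset.univ.filter fun i => ¬ G (x i)).card

open Classical in
theorem numBad_cons {α : Type*} {n : ℕ} (G : α → Prop) (a : α) (x : Fin n → α) :
    numBad G (Fin.cons a x : Fin (n + 1) → α) = (if G a then 0 else 1) + numBad G x := by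
  simp only [numBad, Finset.card_filter, Fin.sum_univ_succ, Fin.cons_zero, Fin.cons_succ]
  by_cases h : G a <;> simp [h]

/-- A Chernoff bound. -/
theorem failsLE_numBad {α : Type*} {μ : PMF α} {G : α → Prop} {q : ℝ≥0∞} (h : FailsLE μ G q) :
    ∀ n j : ℕ, FailsLE (indepFin n fun _ => μ) (fun x => numBad G x < j) ((1 + q) ^ n / 2 ^ j)
  | 0, 0 => by
    rw [pow_zero, pow_zero, div_one]
    exact toOuterMeasure_le_one _ _
  | 0, j + 1 => (FailsLE.pure (by simp [numBad])).mono (fun _ h => h) zero_le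
  | n + 1, 0 => by
    rw [pow_zero, div_one]
    exact (toOuterMeasure_le_one _ _).trans (one_le_pow₀ (le_add_right le_rfl))
  | n + 1, j + 1 => by
    classical
    rw [FailsLE, indepFin, PMF.toOuterMeasure_bind_apply]
    -- This is Markov's inequality for 2^numBad, proved by induction on the first draw. A bad first
    -- draw lowers the threshold from j + 1 to j, which doubles the bound B; bad draws have mass at
    -- most q, so the total is (1 + q)B.
    set B : ℝ≥0∞ := (1 + q) ^ n / 2 ^ (j + 1) with hB
    have hB2 : (1 + q) ^ n / 2 ^ j = B + B := by
      rw [hB, ← ENNReal.add_div, ← two_mul, pow_succ', ENNReal.mul_div_mul_left _ _ (by simp)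
        (by simp)]
    have key : ∀ a, μ a * (((indepFin n fun _ => μ).map fun x => (Fin.cons a x :
        Fin (n + 1) → α)).toOuterMeasure {x | ¬ numBad G x < j + 1}) ≤
        μ a * B + {a | ¬ G a}.indicator μ a * B := by
      intro a
      by_cases ha : G a
      · refine le_add_right (mul_le_mul_right ?_ _)
        exact failsLE_map.2 ((failsLE_numBad h n (j + 1)).mono
          (fun x hx => by simpa [numBad_cons, ha] using hx) le_rfl)
      · rw [Set.indicator_of_mem (show a ∈ {a | ¬ G a} from ha), ← mul_add, ← hB2]
        refine mul_le_mul_right ?_ _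
        exact failsLE_map.2 ((failsLE_numBad h n j).mono
          (fun x hx => by simp only [numBad_cons, ha]; simp; omega) le_rfl)
    calc _ ≤ ∑' a, (μ a * B + {a | ¬ G a}.indicator μ a * B) := ENNReal.tsum_le_tsum key
      _ = B + μ.toOuterMeasure {a | ¬ G a} * B := by
          rw [ENNReal.tsum_add, ENNReal.tsum_mul_right, ENNReal.tsum_mul_right, PMF.tsum_coe,
            one_mul, PMF.toOuterMeasure_apply]
      _ ≤ B + q * B := by gcongr; exact h
      _ = (1 + q) ^ (n + 1) / 2 ^ (j + 1) := by
          rw [hB, pow_succ, ENNReal.div_eq_inv_mul, ENNReal.div_eq_inv_mul]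
          ring

/-- The sorted positions m, …, 2m hold m + 1 entries, none below the median. -/
theorem card_sort_ge {m : ℕ} (x : Fin (2 * m + 1) → ℝ) {p : ℝ → Prop} [DecidablePred p]
    (h : ∀ y, median x ≤ y → p y) : m < (Finset.univ.filter fun i => p (x i)).card := by
  have h1 : ((Finset.Ici (⟨m, by omega⟩ : Fin (2 * m + 1))).map
      (Tuple.sort x).toEmbedding) ⊆ Finset.univ.filter fun i => p (x i) := by
    intro i hi
    obtain ⟨j, hj, rfl⟩ := Finset.mem_map.1 hi
    exact Finset.mem_filter.2 ⟨Finset.mem_univ _, h _ (Tuple.monotone_sort x (Finset.mem_Ici.1 hj))⟩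
  have h2 := Finset.card_le_card h1
  rw [Finset.card_map, Fin.card_Ici] at h2
  simp only at h2
  omega

theorem card_sort_le {m : ℕ} (x : Fin (2 * m + 1) → ℝ) {p : ℝ → Prop} [DecidablePred p]
    (h : ∀ y, y ≤ median x → p y) : m < (Finset.univ.filter fun i => p (x i)).card := by
  have h1 : ((Finset.Iic (⟨m, by omega⟩ : Fin (2 * m + 1))).map
      (Tuple.sort x).toEmbedding) ⊆ Finset.univ.filter fun i => p (x i) := by
    intro i hi
    obtain ⟨j, hj, rfl⟩ := Finset.mem_map.1 hi
    exact Finset.mem_filter.2 ⟨Finset.mem_univ _, h _ (Tuple.monotone_sort x (Finset.mem_Iic.1 hj))⟩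
  have h2 := Finset.card_le_card h1
  rw [Finset.card_map, Fin.card_Iic] at h2
  simp only at h2
  omega

/-- If the median misses c by more than e, then so do, on the same side, all m + 1 entries on that
side of it. -/
theorem abs_median_sub_le {m : ℕ} {x : Fin (2 * m + 1) → ℝ} {c e : ℝ}
    (h : numBad (fun y => |y - c| ≤ e) x < m + 1) : |median x - c| ≤ e := by
  classical
  by_contra hc
  rw [abs_le, not_and_or] at hc
  rcases hc with hc | hc
  · have := card_sort_le x (p := fun y => ¬ |y - c| ≤ e) fun y hy h => hc (by
      have := (abs_le.1 h).1
      linarith)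
    rw [numBad] at h
    omega
  · have := card_sort_ge x (p := fun y => ¬ |y - c| ≤ e) fun y hy h => hc (by
      have := (abs_le.1 h).2
      linarith)
    rw [numBad] at h
    omega

/-- Here 8/9 = (1 + 1/3)²/2 is the factor that the Chernoff bound gains from two extra runs of
failure probability 1/3. As ln(8/9) ≤ -1/9, the constant 9 in `powering` suffices. -/
theorem eight_ninths_pow_le {f : ℝ} (hf : 0 < f) :
    (8 / 9 : ℝ) ^ ⌈9 * Real.log (1 / f)⌉₊ ≤ f := by
  have h1 := Nat.le_ceil (9 * Real.log (1 / f))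
  set m := ⌈9 * Real.log (1 / f)⌉₊
  rw [← Real.log_le_log_iff (by positivity) hf, Real.log_pow]
  have h2 : Real.log (8 / 9) ≤ 8 / 9 - 1 := Real.log_le_sub_one_of_pos (by norm_num)
  rw [one_div, Real.log_inv] at h1
  have h3 : (m : ℝ) * Real.log (8 / 9) ≤ m * (8 / 9 - 1) :=
    mul_le_mul_of_nonneg_left h2 (Nat.cast_nonneg m)
  linarith

theorem failsLE_powering {μ : PMF ℝ} {c e f : ℝ} (hf : 0 < f)
    (h : FailsLE μ (fun y => |y - c| ≤ e) (1 / 3)) :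
    FailsLE (powering f μ) (fun y => |y - c| ≤ e) (ENNReal.ofReal f) := by
  refine failsLE_map.2 ((failsLE_numBad h _ (⌈9 * Real.log (1 / f)⌉₊ + 1)).mono
    (fun x hx => abs_median_sub_le hx) ?_)
  have h1 := eight_ninths_pow_le hf
  set m := ⌈9 * Real.log (1 / f)⌉₊
  have h2 : (1 + 1 / 3 : ℝ≥0∞) = ENNReal.ofReal (4 / 3) := by
    rw [show (4 / 3 : ℝ) = 1 + 1 / 3 by norm_num, ENNReal.ofReal_add (by norm_num) (by norm_num),
      ENNReal.ofReal_div_of_pos (by norm_num)]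
    simp
  have h3 : (2 : ℝ≥0∞) = ENNReal.ofReal 2 := by simp
  rw [h2, h3, ← ENNReal.ofReal_pow (by norm_num), ← ENNReal.ofReal_pow (by norm_num),
    ← ENNReal.ofReal_div_of_pos (by positivity)]
  refine ENNReal.ofReal_le_ofReal ?_
  calc (4 / 3 : ℝ) ^ (2 * m + 1) / 2 ^ (m + 1) = (8 / 9) ^ m * (2 / 3) := by
        rw [pow_succ (4 / 3 : ℝ), pow_mul, pow_succ (2 : ℝ), mul_div_mul_comm, ← div_pow]
        norm_num
    _ ≤ f := by nlinarith

end Median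

/-! ## The Dirichlet kernel -/

section Dirichlet

/-- The two terms are the phase estimation weights of the grid points at distances d and 1 - d from
the phase. For d ≤ 1/4 the first term alone exceeds 0.84² > 2/3. -/
theorem two_thirds_le_sinc_sq_add {d : ℝ} (h0 : 0 ≤ d) (h1 : d ≤ 1) :
    2 / 3 ≤ Real.sinc (Real.pi * d) ^ 2 + Real.sinc (Real.pi * (1 - d)) ^ 2 := by
  wlog h : d ≤ 1 / 2 generalizing d
  · have := this (d := 1 - d) (by linarith) (by linarith) (by linarith)
    rw [sub_sub_cancel] at this
    linarith
  have hpi := Real.pi_gt_three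
  have hpi2 := Real.pi_lt_d4
  rcases h0.eq_or_lt with rfl | hd
  · rw [mul_zero, Real.sinc_zero]
    nlinarith [sq_nonneg (Real.sinc (Real.pi * (1 - 0)))]
  have hx : 0 < Real.pi * d := by positivity
  have hx' : 0 < Real.pi * (1 - d) := mul_pos (by linarith) (by linarith)
  rw [Real.sinc_of_ne_zero hx.ne', Real.sinc_of_ne_zero hx'.ne']
  by_cases hd4 : d ≤ 1 / 4
  · have hx1 : Real.pi * d ≤ 0.7854 := by nlinarith
    have h2 := Real.sin_gt_sub_cube hx
    have h3 : 0.84 ≤ Real.sin (Real.pi * d) / (Real.pi * d) := by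
      rw [le_div_iff₀ hx]
      nlinarith [mul_pos hx hx]
    nlinarith [sq_nonneg (Real.sin (Real.pi * (1 - d)) / (Real.pi * (1 - d)))]
  · have hs : Real.sin (Real.pi * (1 - d)) = Real.sin (Real.pi * d) := by
      rw [← Real.sin_pi_sub]
      congr 1
      ring
    have hc : Real.sin (Real.pi * d) = Real.cos (Real.pi * (1 / 2 - d)) := by
      rw [← Real.cos_pi_div_two_sub]
      congr 1
      ring
    have h2 := Real.one_sub_sq_div_two_le_cos (x := Real.pi * (1 / 2 - d))
    rw [← hc] at h2
    rw [hs]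
    -- Both sines equal cos(π(1/2 - d)), and the symmetric expressions in d and 1 - d are
    -- polynomials in x. With cos y ≥ 1 - y²/2 and π²/2 ≤ 4.935 a polynomial inequality on [0, 1/16]
    -- remains.
    obtain ⟨x, hx⟩ : ∃ x, x = (1 / 2 - d) ^ 2 := ⟨_, rfl⟩
    have hx0 : 0 ≤ x := by rw [hx]; positivity
    have hx1 : x ≤ 1 / 16 := by rw [hx]; nlinarith
    have hpisq : Real.pi ^ 2 ≤ 9.87 := by nlinarith
    have h3 : 1 - 4.935 * x ≤ Real.sin (Real.pi * d) := by
      rw [mul_pow, ← hx] at h2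
      nlinarith
    have h4 : (1 - 4.935 * x) ^ 2 ≤ Real.sin (Real.pi * d) ^ 2 := by
      apply pow_le_pow_left₀ _ h3
      linarith
    rw [div_pow, div_pow, div_add_div _ _ (by positivity) (by positivity),
      le_div_iff₀ (by positivity)]
    have e1 : d ^ 2 + (1 - d) ^ 2 = 1 / 2 + 2 * x := by rw [hx]; ring
    have e2 : d * (1 - d) = 1 / 4 - x := by rw [hx]; ring
    have h5 : (2 / 3) * 9.87 * (1 / 4 - x) ^ 2 ≤ (1 - 4.935 * x) ^ 2 * (1 / 2 + 2 * x) := by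
      nlinarith [mul_nonneg hx0 (sub_nonneg.2 hx1), mul_nonneg hx0 hx0,
        mul_nonneg (mul_nonneg hx0 hx0) (sub_nonneg.2 hx1)]
    have h6 : (2 / 3) * Real.pi ^ 2 * (1 / 4 - x) ^ 2 ≤
        Real.sin (Real.pi * d) ^ 2 * (1 / 2 + 2 * x) := by
      refine le_trans ?_ (h5.trans (mul_le_mul_of_nonneg_right h4 (by linarith)))
      gcongr
    calc 2 / 3 * ((Real.pi * d) ^ 2 * (Real.pi * (1 - d)) ^ 2)
        = Real.pi ^ 2 * ((2 / 3) * Real.pi ^ 2 * (d * (1 - d)) ^ 2) := by ring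
      _ ≤ Real.pi ^ 2 * (Real.sin (Real.pi * d) ^ 2 * (1 / 2 + 2 * x)) := by
          rw [e2]
          exact mul_le_mul_of_nonneg_left h6 (by positivity)
      _ = _ := by rw [← e1]; ring

/-- The normalised Dirichlet kernel. -/
def dirichlet (t : ℕ) (φ : ℝ) : ℂ :=
  (t : ℂ)⁻¹ * ∑ j : Fin t, Complex.exp ((φ * (j : ℕ) : ℝ) * Complex.I)

theorem dirichlet_add_two_pi (t : ℕ) (φ : ℝ) (n : ℤ) :
    dirichlet t (φ + n * (2 * Real.pi)) = dirichlet t φ := by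
  unfold dirichlet
  congr 1
  refine Finset.sum_congr rfl fun j _ => ?_
  rw [Complex.exp_eq_exp_iff_exists_int]
  refine ⟨n * (j : ℕ), ?_⟩
  push_cast
  ring

/-- Summing the geometric series gives |sin(tφ/2)| = N |sin(φ/2)| for the norm N of the sum, and
|sin(φ/2)| ≤ |φ/2|. The product form also covers sin(φ/2) = 0. -/
theorem abs_sinc_le_norm_dirichlet {t : ℕ} (ht : 0 < t) (φ : ℝ) :
    |Real.sinc (t * φ / 2)| ≤ ‖dirichlet t φ‖ := by
  have ht' : (0 : ℝ) < t := Nat.cast_pos.2 ht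
  have hexp : ∀ j : ℕ, Complex.exp ((φ * j : ℝ) * Complex.I) =
      Complex.exp (Complex.I * φ) ^ j := by
    intro j
    rw [← Complex.exp_nat_mul]
    congr 1
    push_cast
    ring
  rcases eq_or_ne φ 0 with rfl | hφ
  · simp [dirichlet, ht.ne']
  · have hx : (t * φ / 2 : ℝ) ≠ 0 := by positivity
    rw [Real.sinc_of_ne_zero hx, abs_div, div_le_iff₀ (abs_pos.2 hx)]
    have h1 : (∑ j : Fin t, Complex.exp ((φ * (j : ℕ) : ℝ) * Complex.I)) *
        (Complex.exp (Complex.I * φ) - 1) = Complex.exp (Complex.I * (t * φ : ℝ)) - 1 := by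
      simp_rw [hexp]
      rw [Fin.sum_univ_eq_sum_range fun j => Complex.exp (Complex.I * φ) ^ j, geom_sum_mul,
        ← Complex.exp_nat_mul]
      congr 2
      push_cast
      ring
    have h2 := congrArg norm h1
    rw [norm_mul, Complex.norm_exp_I_mul_ofReal_sub_one, Complex.norm_exp_I_mul_ofReal_sub_one,
      norm_mul, norm_mul, Real.norm_ofNat, Real.norm_eq_abs, Real.norm_eq_abs] at h2
    have h3 : |Real.sin (φ / 2)| ≤ |φ / 2| := Real.abs_sin_le_abs
    have h4 : |t * φ / 2| = t * |φ / 2| := by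
      rw [mul_div_assoc, abs_mul, abs_of_pos ht']
    rw [dirichlet, norm_mul, norm_inv, Complex.norm_natCast, h4]
    set N := ‖∑ j : Fin t, Complex.exp ((φ * (j : ℕ) : ℝ) * Complex.I)‖
    have h5 : |Real.sin (t * φ / 2)| = N * |Real.sin (φ / 2)| := by
      linarith
    calc |Real.sin (t * φ / 2)| = N * |Real.sin (φ / 2)| := h5
      _ ≤ N * |φ / 2| := mul_le_mul_of_nonneg_left h3 (norm_nonneg _)
      _ = (t : ℝ)⁻¹ * N * (t * |φ / 2|) := by field_simp

/-- Phase estimation finds one of the two nearest grid points with probability at least `2 / 3`. -/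
theorem two_thirds_le_sum_dirichlet {t : ℕ} (ht : 2 ≤ t) (θ : ℝ) (G : Finset (Fin t))
    (hG : ∀ (y : Fin t) (n k : ℤ), ((y : ℕ) : ℤ) = n + t * k →
      |Real.pi * n / t - θ| ≤ Real.pi / t → y ∈ G) :
    2 / 3 ≤ ∑ y ∈ G, ‖dirichlet t (2 * θ - 2 * Real.pi * (y : ℕ) / t)‖ ^ 2 := by
  have ht' : (0 : ℝ) < t := by positivity
  have htz : (t : ℤ) ≠ 0 := by omega
  have hpi := Real.pi_pos
  -- The grid is cyclic: c reduces an integer modulo t, and the kernel does not notice because it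
  -- has period 2π.
  let c : ℤ → Fin t := fun n => ⟨(n % t).toNat, by
    have := Int.emod_nonneg n htz
    have := Int.emod_lt_of_pos n (b := (t : ℤ)) (by omega)
    omega⟩
  have hc : ∀ n : ℤ, (((c n : Fin t) : ℕ) : ℤ) = n + t * (-(n / t)) := by
    intro n
    change ((n % t).toNat : ℤ) = _
    rw [Int.toNat_of_nonneg (Int.emod_nonneg n htz)]
    linarith [Int.emod_add_mul_ediv n t]
  have hD : ∀ n : ℤ, dirichlet t (2 * θ - 2 * Real.pi * (c n : ℕ) / t) =
      dirichlet t (2 * θ - 2 * Real.pi * n / t) := by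
    intro n
    have h1 : ((c n : ℕ) : ℝ) = n + t * (-((n / t : ℤ) : ℝ)) := by exact_mod_cast hc n
    rw [h1]
    refine Eq.trans ?_ (dirichlet_add_two_pi t _ (n / t))
    congr 1
    field_simp
    ring
  -- In grid units the phase sits at ω, between the neighbours a and a + 1; these are distinct
  -- modulo t because t ≥ 2. The sinc arguments are π(ω - a) and, up to sign, π(1 - (ω - a)).
  set ω : ℝ := t * θ / Real.pi with hω
  set a : ℤ := ⌊ω⌋
  have ha0 : (a : ℝ) ≤ ω := Int.floor_le ω
  have ha1 : ω < a + 1 := Int.lt_floor_add_one ω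
  have hθ : θ = Real.pi * ω / t := by rw [hω]; field_simp
  have hclose : ∀ n : ℤ, |n - ω| ≤ 1 → c n ∈ G := by
    intro n hn
    refine hG _ n _ (hc n) ?_
    have : Real.pi * n / t - θ = Real.pi / t * (n - ω) := by rw [hθ]; ring
    rw [this, abs_mul, abs_of_pos (by positivity)]
    exact mul_le_of_le_one_right (by positivity) hn
  have hne : c a ≠ c (a + 1) := by
    intro h
    have h1 := hc a
    rw [h, hc (a + 1)] at h1
    have h2 : (t : ℤ) ∣ 1 := ⟨(a + 1) / t - a / t, by linarith⟩
    have := Int.le_of_dvd one_pos h2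
    omega
  have hsub : ({c a, c (a + 1)} : Finset (Fin t)) ⊆ G := by
    intro y hy
    rw [Finset.mem_insert, Finset.mem_singleton] at hy
    rcases hy with rfl | rfl
    · exact hclose a (by rw [abs_le]; constructor <;> linarith)
    · exact hclose (a + 1) (by push_cast; rw [abs_le]; constructor <;> linarith)
  refine le_trans ?_ (Finset.sum_le_sum_of_subset_of_nonneg hsub fun _ _ _ => by positivity)
  rw [Finset.sum_pair hne, hD, hD]
  refine (two_thirds_le_sinc_sq_add (d := ω - a) (by linarith) (by linarith)).trans ?_
  refine add_le_add ?_ ?_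
  · rw [← sq_abs]
    refine pow_le_pow_left₀ (abs_nonneg _) ?_ 2
    refine (le_of_eq ?_).trans (abs_sinc_le_norm_dirichlet (by omega) _)
    rw [hθ]
    congr 2
    field_simp
  · rw [← sq_abs]
    refine pow_le_pow_left₀ (abs_nonneg _) ?_ 2
    refine (le_of_eq ?_).trans (abs_sinc_le_norm_dirichlet (by omega) _)
    rw [hθ, ← Real.sinc_neg]
    congr 2
    push_cast
    field_simp
    ring

/-- The difference is sin(2θ + x) sin x with x = φ - θ; expanding the first factor isolates sin 2θ,
the source of the factor 2√(μ(1-μ)) when sin²θ = μ. -/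
theorem abs_sin_sq_sub_le {θ φ h : ℝ} (hh : |φ - θ| ≤ h) :
    |Real.sin φ ^ 2 - Real.sin θ ^ 2| ≤ 2 * |Real.sin θ * Real.cos θ| * h + h ^ 2 := by
  obtain ⟨x, rfl⟩ : ∃ x, φ = θ + x := ⟨φ - θ, by ring⟩
  rw [add_sub_cancel_left] at hh
  have h1 : Real.sin (θ + x) ^ 2 - Real.sin θ ^ 2 =
      (2 * (Real.sin θ * Real.cos θ) * Real.cos x +
        (Real.cos θ ^ 2 - Real.sin θ ^ 2) * Real.sin x) * Real.sin x := by
    rw [Real.sin_add]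
    have := Real.sin_sq_add_cos_sq x
    linear_combination (Real.sin θ ^ 2) * this
  have h2 : |Real.sin x| ≤ h := Real.abs_sin_le_abs.trans hh
  have h3 : |Real.cos x| ≤ 1 := Real.abs_cos_le_one x
  have h4 : |Real.cos θ ^ 2 - Real.sin θ ^ 2| ≤ 1 := by
    rw [abs_le]
    have := Real.sin_sq_add_cos_sq θ
    constructor <;> nlinarith [sq_nonneg (Real.sin θ), sq_nonneg (Real.cos θ)]
  have h0 := abs_nonneg (Real.sin x)
  rw [h1, abs_mul]
  calc _ ≤ (2 * |Real.sin θ * Real.cos θ| * 1 + 1 * h) * h := by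
        refine mul_le_mul ((abs_add_le _ _).trans (add_le_add ?_ ?_)) h2 h0 ?_
        · rw [abs_mul, abs_mul, abs_two]
          gcongr
        · rw [abs_mul]
          gcongr
        · have := h0.trans h2
          positivity
    _ = _ := by ring

end Dirichlet

/-! ## Amplitude estimation -/

section AmplitudeEstimation

variable {X : Type*} [Fintype X] [DecidableEq X]

theorem signMatrix_mulVec (good : X → Prop) [DecidablePred good] (u : X → ℂ) (x : X) :
    ((signMatrix good : Matrix X X ℂ) *ᵥ u) x = if good x then u x else -u x := by
  change (diagonal _ *ᵥ u) x = _
  rw [mulVec_diagonal]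
  split_ifs <;> simp

/-- Conjugating 2|x₀⟩⟨x₀| - 1 by V gives 2|ψ⟩⟨ψ| - 1 with ψ = V|x₀⟩. -/
theorem reflection_mulVec (V : unitaryGroup X ℂ) (x₀ : X) (u : X → ℂ) (x : X) :
    ((V : Matrix X X ℂ) *ᵥ ((signMatrix (fun x => x = x₀) : Matrix X X ℂ) *ᵥ
      (((V⁻¹ : unitaryGroup X ℂ) : Matrix X X ℂ) *ᵥ u))) x =
      2 * (V : Matrix X X ℂ) x x₀ * (∑ y, star ((V : Matrix X X ℂ) y x₀) * u y) - u x := by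
  set w := ((V⁻¹ : unitaryGroup X ℂ) : Matrix X X ℂ) *ᵥ u with hw
  have h1 : (signMatrix (fun x => x = x₀) : Matrix X X ℂ) *ᵥ w =
      Pi.single x₀ (2 * w x₀) - w := by
    funext y
    rw [signMatrix_mulVec, Pi.sub_apply]
    by_cases h : y = x₀
    · subst h
      simp only [if_true, Pi.single_eq_same]
      ring
    · simp [h]
  have h2 : (V : Matrix X X ℂ) *ᵥ w = u := by
    rw [hw, mulVec_mulVec, ← UnitaryGroup.mul_val, mul_inv_cancel, UnitaryGroup.one_val,
      one_mulVec]
  have h3 : w x₀ = ∑ y, star ((V : Matrix X X ℂ) y x₀) * u y := by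
    rw [hw, UnitaryGroup.inv_val]
    rfl
  rw [h1, mulVec_sub, h2, Pi.sub_apply, mulVec_single, h3]
  simp only [MulOpposite.smul_eq_mul_unop, MulOpposite.unop_op, Pi.smul_apply, col_apply]
  ring

theorem grover_mulVec (V : unitaryGroup X ℂ) (x₀ : X) (good : X → Prop) [DecidablePred good]
    (u : X → ℂ) (x : X) :
    ((grover V x₀ good : Matrix X X ℂ) *ᵥ u) x =
      2 * (V : Matrix X X ℂ) x x₀ * (∑ y, star ((V : Matrix X X ℂ) y x₀) *
        (if good y then -u y else u y)) - (if good x then -u x else u x) := by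
  have h : (signMatrix (fun x => ¬ good x) : Matrix X X ℂ) *ᵥ u =
      fun y => if good y then -u y else u y := by
    funext y
    rw [signMatrix_mulVec]
    by_cases h : good y <;> simp [h]
  rw [grover, UnitaryGroup.mul_val, UnitaryGroup.mul_val, UnitaryGroup.mul_val, ← mulVec_mulVec,
    ← mulVec_mulVec, ← mulVec_mulVec, h, reflection_mulVec]

/-- The amplification operator rotates the plane spanned by the good and bad parts of `V |x₀⟩`. -/
theorem grover_pow_mulVec (V : unitaryGroup X ℂ) (x₀ : X) (good : X → Prop) [DecidablePred good]
    {g b : X → ℂ} {θ : ℝ} (hg : ∀ x, ¬ good x → g x = 0) (hb : ∀ x, good x → b x = 0)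
    (hV : ∀ x, (V : Matrix X X ℂ) x x₀ = Real.sin θ * g x + Real.cos θ * b x)
    (hVg : ∑ y, star ((V : Matrix X X ℂ) y x₀) * g y = Real.sin θ)
    (hVb : ∑ y, star ((V : Matrix X X ℂ) y x₀) * b y = Real.cos θ) (j : ℕ) (x : X) :
    (((grover V x₀ good ^ j : unitaryGroup X ℂ) : Matrix X X ℂ) *ᵥ
      fun x => (V : Matrix X X ℂ) x x₀) x =
      Real.sin ((2 * j + 1) * θ) * g x + Real.cos ((2 * j + 1) * θ) * b x := by
  induction j generalizing x with
  | zero =>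
    rw [pow_zero, UnitaryGroup.one_val, one_mulVec, hV]
    simp
  | succ j ih =>
    rw [pow_succ', UnitaryGroup.mul_val, ← mulVec_mulVec, grover_mulVec]
    simp_rw [ih]
    set s := Real.sin ((2 * j + 1) * θ) with hs
    set c := Real.cos ((2 * j + 1) * θ) with hc
    have h1 : ∀ y, (if good y then -((s : ℂ) * g y + c * b y) else s * g y + c * b y) =
        -s * g y + c * b y := by
      intro y
      split_ifs with h
      · rw [hb y h]
        ring
      · rw [hg y h]
        ring
    simp_rw [h1]
    have h2 : ∑ y, star ((V : Matrix X X ℂ) y x₀) * (-(s : ℂ) * g y + c * b y) =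
        -s * Real.sin θ + c * Real.cos θ := by
      rw [← hVg, ← hVb, Finset.mul_sum, Finset.mul_sum, ← Finset.sum_add_distrib]
      exact Finset.sum_congr rfl fun y _ => by ring
    have h3 : (2 * ((j + 1 : ℕ) : ℝ) + 1) * θ = (2 * j + 1) * θ + 2 * θ := by
      push_cast
      ring
    -- With h2 the new coefficients of g and b are s cos 2θ + c sin 2θ and c cos 2θ - s sin 2θ, a
    -- rotation by 2θ.
    have h4 : (Real.sin θ : ℂ) ^ 2 + (Real.cos θ : ℂ) ^ 2 = 1 := by
      exact_mod_cast Real.sin_sq_add_cos_sq θ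
    rw [h2, hV, h3, Real.sin_add, Real.cos_add, ← hs, ← hc, Real.sin_two_mul, Real.cos_two_mul]
    push_cast at h4 ⊢
    linear_combination (-2 * (s : ℂ) * g x) * h4

/-- The amplitudes before the measurement of amplitude estimation. -/
theorem ampEst_amplitude (V : unitaryGroup X ℂ) (x₀ : X) (good : X → Prop) [DecidablePred good]
    (t : ℕ) [NeZero t] (x : X) (y : Fin t) :
    (tensor 1 (qft t)⁻¹ * controlled (fun j : Fin t => grover V x₀ good ^ (j : ℕ)) *
      tensor V (qft t) : unitaryGroup (X × Fin t) ℂ).1 (x, y) (x₀, (0 : Fin t)) =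
    (t : ℂ)⁻¹ * ∑ j : Fin t,
      Complex.exp ((-(2 * Real.pi * (y : ℕ) / t) * (j : ℕ) : ℝ) * Complex.I) *
      (((grover V x₀ good ^ (j : ℕ) : unitaryGroup X ℂ) : Matrix X X ℂ) *ᵥ
        fun x => (V : Matrix X X ℂ) x x₀) x := by
  have hs : (√(t : ℝ) : ℂ)⁻¹ * (√(t : ℝ) : ℂ)⁻¹ = (t : ℂ)⁻¹ := by
    rw [← mul_inv, ← Complex.ofReal_mul, Real.mul_self_sqrt (Nat.cast_nonneg t),
      Complex.ofReal_natCast]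
  have h1 : ∀ j : Fin t, qftMatrix t j 0 = (√(t : ℝ) : ℂ)⁻¹ := by
    intro j
    simp [qftMatrix]
  have h2 : ∀ j : Fin t, star (qftMatrix t j y) = (√(t : ℝ) : ℂ)⁻¹ *
      Complex.exp ((-(2 * Real.pi * (y : ℕ) / t) * (j : ℕ) : ℝ) * Complex.I) := by
    intro j
    simp only [qftMatrix, of_apply, star_mul', Complex.star_def, map_inv₀, Complex.conj_ofReal,
      ← Complex.exp_conj, map_div₀, map_mul, Complex.conj_I, map_natCast, map_ofNat]
    congr 2
    push_cast
    ring
  rw [mul_assoc]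
  change ((1 : Matrix X X ℂ) ⊗ₖ (star (qftMatrix t)) *
    ((blockDiagonal fun j : Fin t => ((grover V x₀ good ^ (j : ℕ) : unitaryGroup X ℂ) :
      Matrix X X ℂ)) * ((V : Matrix X X ℂ) ⊗ₖ qftMatrix t))) (x, y) (x₀, 0) = _
  rw [Matrix.mul_apply, Fintype.sum_prod_type, Finset.sum_eq_single x, Finset.mul_sum]
  · refine Finset.sum_congr rfl fun j _ => ?_
    rw [kroneckerMap_apply, one_apply_eq, one_mul, star_apply, h2, Matrix.mul_apply,
      Fintype.sum_prod_type]
    have h3 : ∀ x', ∑ j' : Fin t, (blockDiagonal fun j : Fin t => ((grover V x₀ good ^ (j : ℕ) :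
        unitaryGroup X ℂ) : Matrix X X ℂ)) (x, j) (x', j') *
        ((V : Matrix X X ℂ) ⊗ₖ qftMatrix t) (x', j') (x₀, 0) =
        (√(t : ℝ) : ℂ)⁻¹ * (((grover V x₀ good ^ (j : ℕ) : unitaryGroup X ℂ) : Matrix X X ℂ) x x' *
          (V : Matrix X X ℂ) x' x₀) := by
      intro x'
      rw [Finset.sum_eq_single j]
      · rw [blockDiagonal_apply_eq, kroneckerMap_apply, h1]
        ring
      · intro j' _ hj'
        rw [blockDiagonal_apply_ne _ _ _ hj'.symm, zero_mul]
      · simp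
    simp_rw [h3]
    rw [← Finset.mul_sum, ← hs]
    change _ = _ * (_ * ∑ x', _)
    ring
  · intro x' _ hx'
    refine Finset.sum_eq_zero fun j _ => ?_
    rw [kroneckerMap_apply, one_apply_ne hx'.symm, zero_mul, zero_mul]
  · simp

/-- Serves the degenerate case in which the normalised good part is 0 and its coefficient has to
vanish as well. -/
theorem sin_odd_mul_eq_zero {θ : ℝ} (h : Real.sin θ = 0) (j : ℕ) :
    Real.sin ((2 * j + 1) * θ) = 0 := by
  induction j with
  | zero => simpa using h
  | succ j ih =>
    rw [show (2 * ((j + 1 : ℕ) : ℝ) + 1) * θ = (2 * j + 1) * θ + 2 * θ by push_cast; ring,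
      Real.sin_add, ih, Real.sin_two_mul, h]
    ring

theorem cos_odd_mul_eq_zero {θ : ℝ} (h : Real.cos θ = 0) (j : ℕ) :
    Real.cos ((2 * j + 1) * θ) = 0 := by
  induction j with
  | zero => simpa using h
  | succ j ih =>
    rw [show (2 * ((j + 1 : ℕ) : ℝ) + 1) * θ = (2 * j + 1) * θ + 2 * θ by push_cast; ring,
      Real.cos_add, ih, Real.sin_two_mul, h]
    ring

/-- The outcome distribution of amplitude estimation. -/
theorem sum_ampEst_amplitude (V : unitaryGroup X ℂ) (x₀ : X) (good : X → Prop)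
    [DecidablePred good] (t : ℕ) [NeZero t] {θ : ℝ}
    (hθ : ∑ x with good x, ‖(V : Matrix X X ℂ) x x₀‖ ^ 2 = Real.sin θ ^ 2) (y : Fin t) :
    ∑ x, ‖(tensor 1 (qft t)⁻¹ * controlled (fun j : Fin t => grover V x₀ good ^ (j : ℕ)) *
      tensor V (qft t) : unitaryGroup (X × Fin t) ℂ).1 (x, y) (x₀, (0 : Fin t))‖ ^ 2 =
    (‖dirichlet t (2 * θ - 2 * Real.pi * (y : ℕ) / t)‖ ^ 2 +
      ‖dirichlet t (2 * (-θ) - 2 * Real.pi * (y : ℕ) / t)‖ ^ 2) / 2 := by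
  set ψ : X → ℂ := fun x => (V : Matrix X X ℂ) x x₀ with hψ
  have hone : ∑ x, ‖ψ x‖ ^ 2 = 1 := by
    have h := sum_born V x₀
    rw [← ENNReal.ofReal_sum_of_nonneg fun _ _ => by positivity, ENNReal.ofReal_eq_one] at h
    exact h
  have hbad : ∑ x with ¬ good x, ‖ψ x‖ ^ 2 = Real.cos θ ^ 2 := by
    have := Finset.sum_filter_add_sum_filter_not Finset.univ good fun x => ‖ψ x‖ ^ 2
    rw [hone, hθ] at this
    linarith [Real.sin_sq_add_cos_sq θ]
  -- Normalised good and bad parts of ψ. If sin θ = 0, division by zero makes g = 0, and ψ vanishes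
  -- on the good states anyway, so the decomposition `hV` persists; likewise for cos θ and b.
  set g : X → ℂ := fun x => if good x then ψ x / Real.sin θ else 0 with hg
  set b : X → ℂ := fun x => if good x then 0 else ψ x / Real.cos θ with hb
  have hψg : ∀ x, good x → Real.sin θ = 0 → ψ x = 0 := by
    intro x hx h
    rw [h, zero_pow two_ne_zero, Finset.sum_eq_zero_iff_of_nonneg fun _ _ => by positivity] at hθ
    simpa using hθ x (by simpa using hx)
  have hψb : ∀ x, ¬ good x → Real.cos θ = 0 → ψ x = 0 := by
    intro x hx h
    rw [h, zero_pow two_ne_zero, Finset.sum_eq_zero_iff_of_nonneg fun _ _ => by positivity] at hbad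
    simpa using hbad x (by simpa using hx)
  have hV : ∀ x, ψ x = Real.sin θ * g x + Real.cos θ * b x := by
    intro x
    by_cases hx : good x
    · simp only [hg, hb, hx, if_true, mul_zero, add_zero]
      by_cases h : Real.sin θ = 0
      · rw [hψg x hx h, zero_div, mul_zero]
      · rw [mul_div_cancel₀ _ (Complex.ofReal_ne_zero.2 h)]
    · simp only [hg, hb, hx, if_false, mul_zero, zero_add]
      by_cases h : Real.cos θ = 0
      · rw [hψb x hx h, zero_div, mul_zero]
      · rw [mul_div_cancel₀ _ (Complex.ofReal_ne_zero.2 h)]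
  have hVg : ∑ y, star (ψ y) * g y = Real.sin θ := by
    have h1 : ∀ y, star (ψ y) * g y =
        if good y then ((‖ψ y‖ ^ 2 / Real.sin θ : ℝ) : ℂ) else 0 := by
      intro y
      simp only [hg]
      split_ifs
      · rw [mul_div_assoc', Complex.star_def, Complex.conj_mul']
        push_cast
        rfl
      · rw [mul_zero]
    rw [Finset.sum_congr rfl fun y _ => h1 y, ← Finset.sum_filter, ← Complex.ofReal_sum,
      ← Finset.sum_div, hθ, sq, mul_self_div_self]
  have hVb : ∑ y, star (ψ y) * b y = Real.cos θ := by
    have h1 : ∀ y, star (ψ y) * b y =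
        if ¬ good y then ((‖ψ y‖ ^ 2 / Real.cos θ : ℝ) : ℂ) else 0 := by
      intro y
      simp only [hb]
      by_cases h : good y
      · simp [h]
      · simp only [h, if_false, not_false_eq_true, if_true]
        rw [mul_div_assoc', Complex.star_def, Complex.conj_mul']
        push_cast
        rfl
    rw [Finset.sum_congr rfl fun y _ => h1 y, ← Finset.sum_filter, ← Complex.ofReal_sum,
      ← Finset.sum_div, hbad, sq, mul_self_div_self]
  set e : Fin t → ℂ := fun j =>
    Complex.exp ((-(2 * Real.pi * (y : ℕ) / t) * (j : ℕ) : ℝ) * Complex.I) with he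
  set sn : ℂ := (t : ℂ)⁻¹ * ∑ j : Fin t, e j * Real.sin ((2 * (j : ℕ) + 1) * θ) with hsn
  set cs : ℂ := (t : ℂ)⁻¹ * ∑ j : Fin t, e j * Real.cos ((2 * (j : ℕ) + 1) * θ) with hcs
  have hamp : ∀ x, (tensor 1 (qft t)⁻¹ * controlled (fun j : Fin t => grover V x₀ good ^ (j : ℕ)) *
      tensor V (qft t) : unitaryGroup (X × Fin t) ℂ).1 (x, y) (x₀, (0 : Fin t)) =
      sn * g x + cs * b x := by
    intro x
    rw [ampEst_amplitude]
    simp_rw [grover_pow_mulVec V x₀ good (g := g) (b := b) (θ := θ) (fun x hx => by simp [hg, hx])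
      (fun x hx => by simp [hb, hx]) hV hVg hVb]
    rw [hsn, hcs, mul_assoc (t : ℂ)⁻¹, mul_assoc (t : ℂ)⁻¹, ← mul_add, Finset.sum_mul,
      Finset.sum_mul, ← Finset.sum_add_distrib]
    congr 1
    exact Finset.sum_congr rfl fun j _ => by ring
  simp_rw [hamp]
  -- The vectors g and b have disjoint supports, so the squared norms add.
  have hsplit : ∑ x, ‖sn * g x + cs * b x‖ ^ 2 = ‖sn‖ ^ 2 + ‖cs‖ ^ 2 := by
    rw [← Finset.sum_filter_add_sum_filter_not Finset.univ good]
    congr 1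
    · have h1 : ∀ x ∈ Finset.univ.filter good, ‖sn * g x + cs * b x‖ ^ 2 =
          ‖sn‖ ^ 2 * (‖ψ x‖ ^ 2 / Real.sin θ ^ 2) := by
        intro x hx
        have hx := (Finset.mem_filter.1 hx).2
        simp only [hg, hb, hx, if_true, mul_zero, add_zero]
        rw [norm_mul, norm_div, mul_pow, div_pow, Complex.norm_real, Real.norm_eq_abs, sq_abs]
      rw [Finset.sum_congr rfl h1, ← Finset.mul_sum, ← Finset.sum_div, hθ]
      by_cases h : Real.sin θ = 0
      · simp [hsn, sin_odd_mul_eq_zero h]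
      · rw [div_self (pow_ne_zero 2 h), mul_one]
    · have h1 : ∀ x ∈ Finset.univ.filter (fun x => ¬ good x), ‖sn * g x + cs * b x‖ ^ 2 =
          ‖cs‖ ^ 2 * (‖ψ x‖ ^ 2 / Real.cos θ ^ 2) := by
        intro x hx
        have hx := (Finset.mem_filter.1 hx).2
        simp only [hg, hb, hx, if_false, mul_zero, zero_add]
        rw [norm_mul, norm_div, mul_pow, div_pow, Complex.norm_real, Real.norm_eq_abs, sq_abs]
      rw [Finset.sum_congr rfl h1, ← Finset.mul_sum, ← Finset.sum_div, hbad]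
      by_cases h : Real.cos θ = 0
      · simp [hcs, cos_odd_mul_eq_zero h]
      · rw [div_self (pow_ne_zero 2 h), mul_one]
  -- By Euler's formula cs ± i·sn are Dirichlet kernels at ±θ up to a phase; the parallelogram law
  -- then expresses ‖sn‖² + ‖cs‖² through them.
  have hplus : ‖cs + sn * Complex.I‖ = ‖dirichlet t (2 * θ - 2 * Real.pi * (y : ℕ) / t)‖ := by
    have : cs + sn * Complex.I = Complex.exp (θ * Complex.I) *
        dirichlet t (2 * θ - 2 * Real.pi * (y : ℕ) / t) := by
      rw [hcs, hsn, dirichlet, mul_assoc, ← mul_add, mul_left_comm, Finset.sum_mul,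
        ← Finset.sum_add_distrib]
      congr 1
      rw [Finset.mul_sum]
      refine Finset.sum_congr rfl fun j _ => ?_
      rw [mul_assoc, ← mul_add, Complex.ofReal_cos, Complex.ofReal_sin, ← Complex.exp_mul_I, he,
        ← Complex.exp_add, ← Complex.exp_add]
      congr 1
      push_cast
      ring
    rw [this, norm_mul, Complex.norm_exp_ofReal_mul_I, one_mul]
  have hminus : ‖cs - sn * Complex.I‖ = ‖dirichlet t (2 * (-θ) - 2 * Real.pi * (y : ℕ) / t)‖ := by
    have : cs - sn * Complex.I = Complex.exp ((-θ : ℝ) * Complex.I) *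
        dirichlet t (2 * (-θ) - 2 * Real.pi * (y : ℕ) / t) := by
      rw [hcs, hsn, dirichlet, mul_assoc, ← mul_sub, mul_left_comm, Finset.sum_mul,
        ← Finset.sum_sub_distrib]
      congr 1
      rw [Finset.mul_sum]
      refine Finset.sum_congr rfl fun j _ => ?_
      have h1 : (Real.cos ((2 * (j : ℕ) + 1) * θ) : ℂ) -
          Real.sin ((2 * (j : ℕ) + 1) * θ) * Complex.I =
          Complex.exp (((2 * (j : ℕ) + 1) * (-θ) : ℝ) * Complex.I) := by
        rw [Complex.exp_mul_I, ← Complex.ofReal_cos, ← Complex.ofReal_sin, mul_neg, Real.cos_neg,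
          Real.sin_neg]
        push_cast
        ring
      rw [mul_assoc, ← mul_sub, h1, he, ← Complex.exp_add, ← Complex.exp_add]
      congr 1
      push_cast
      ring
    rw [this, norm_mul, Complex.norm_exp_ofReal_mul_I, one_mul]
  rw [hsplit, ← hplus, ← hminus]
  have := parallelogram_law_with_norm ℝ cs (sn * Complex.I)
  rw [norm_mul sn, Complex.norm_I, mul_one] at this
  linarith

/-- The outcome is an equal mixture of phase estimation for θ and for -θ. Both lead to the same
estimate since sin² is even, and wrapping around the grid is harmless since sin² has period π. -/
theorem failsLE_ampEst (V : unitaryGroup X ℂ) (x₀ : X) (good : X → Prop) [DecidablePred good]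
    {t : ℕ} [NeZero t] (ht : 2 ≤ t) {μ : ℝ}
    (hμ : ∑ x with good x, ‖(V : Matrix X X ℂ) x x₀‖ ^ 2 = μ) :
    FailsLE (ampEst V x₀ good t)
      (fun m => |m - μ| ≤ 2 * √(μ * (1 - μ)) * (Real.pi / t) + (Real.pi / t) ^ 2) (1 / 3) := by
  have hone : ∑ x, ‖(V : Matrix X X ℂ) x x₀‖ ^ 2 = 1 := by
    have h := sum_born V x₀
    rw [← ENNReal.ofReal_sum_of_nonneg fun _ _ => by positivity, ENNReal.ofReal_eq_one] at h
    exact h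
  have hμ0 : 0 ≤ μ := by
    rw [← hμ]
    positivity
  have hμ1 : μ ≤ 1 := by
    rw [← hμ, ← hone]
    exact Finset.sum_le_sum_of_subset_of_nonneg (Finset.filter_subset _ _)
      fun _ _ _ => by positivity
  obtain ⟨θ, hθ⟩ : ∃ θ, Real.sin θ ^ 2 = μ := ⟨Real.arcsin √μ, by
    rw [Real.sin_arcsin (by linarith [Real.sqrt_nonneg μ]) (Real.sqrt_le_one.2 hμ1),
      Real.sq_sqrt hμ0]⟩
  have hsc : √(μ * (1 - μ)) = |Real.sin θ * Real.cos θ| := by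
    rw [← hθ, ← Real.cos_sq', ← mul_pow, Real.sqrt_sq_eq_abs]
  classical
  set G : ℝ → Prop := fun m =>
    |m - μ| ≤ 2 * √(μ * (1 - μ)) * (Real.pi / t) + (Real.pi / t) ^ 2 with hGdef
  set F : Finset (Fin t) := Finset.univ.filter fun y => G (Real.sin (Real.pi * (y : ℕ) / t) ^ 2)
    with hF
  have ht' : (t : ℝ) ≠ 0 := by positivity
  have hmem : ∀ θ' : ℝ, (θ' = θ ∨ θ' = -θ) → ∀ (y : Fin t) (n k : ℤ),
      ((y : ℕ) : ℤ) = n + t * k → |Real.pi * n / t - θ'| ≤ Real.pi / t → y ∈ F := by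
    intro θ' hθ' y n k hy hn
    have h1 : Real.sin (Real.pi * (y : ℕ) / t) ^ 2 = Real.sin (Real.pi * n / t) ^ 2 := by
      have h2 : ((y : ℕ) : ℝ) = n + t * k := by exact_mod_cast hy
      have h3 : Real.pi * (y : ℕ) / t = Real.pi * n / t + k * Real.pi := by
        rw [h2]
        field_simp
      rw [h3, Real.sin_add_int_mul_pi, mul_pow, ← sq_abs ((-1 : ℝ) ^ k)]
      simp
    have h4 := abs_sin_sq_sub_le hn
    refine Finset.mem_filter.2 ⟨Finset.mem_univ _, ?_⟩
    rw [h1, hGdef]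
    simp only
    rw [hsc, ← hθ]
    rcases hθ' with rfl | rfl
    · exact h4
    · rw [Real.sin_neg, Real.cos_neg, neg_sq, neg_mul, abs_neg] at h4
      exact h4
  refine failsLE_map.2 (failsLE_of_le_toOuterMeasure (p := ENNReal.ofReal (2 / 3)) ?_ ?_
    ENNReal.ofReal_ne_top)
  · have hset : {xy : X × Fin t | G (Real.sin (Real.pi * (xy.2 : ℕ) / t) ^ 2)} =
        ((Finset.univ ×ˢ F : Finset (X × Fin t)) : Set (X × Fin t)) := by
      ext xy
      simp [hF]
    rw [hset, PMF.toOuterMeasure_apply_finset, Finset.sum_product_right]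
    simp only [measureOutcome, PMF.ofFintype_apply]
    rw [← Finset.sum_congr rfl fun y _ => ENNReal.ofReal_sum_of_nonneg fun _ _ => by positivity,
      ← ENNReal.ofReal_sum_of_nonneg fun _ _ => by positivity]
    refine ENNReal.ofReal_le_ofReal ?_
    rw [Finset.sum_congr rfl fun y _ => sum_ampEst_amplitude V x₀ good t (hμ.trans hθ.symm) y,
      ← Finset.sum_div, Finset.sum_add_distrib]
    have h1 := two_thirds_le_sum_dirichlet ht θ F (hmem θ (Or.inl rfl))
    have h2 := two_thirds_le_sum_dirichlet ht (-θ) F (hmem (-θ) (Or.inr rfl))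
    linarith
  · rw [show (1 / 3 : ENNReal) = ENNReal.ofReal (1 / 3) by
      rw [ENNReal.ofReal_div_of_pos (by norm_num)]; simp,
      ← ENNReal.ofReal_add (by norm_num) (by norm_num)]
    norm_num

end AmplitudeEstimation

/-! ## Dyadic bands -/

section Bands

variable {S : Type*}

theorem band_nonneg {z : S → ℝ} (hz : ∀ s', 0 ≤ z s') (l : ℕ) (s' : S) : 0 ≤ band z l s' := by
  unfold band
  split_ifs
  · exact div_nonneg (hz s') (by positivity)
  · exact le_rfl

theorem band_le_one (z : S → ℝ) (l : ℕ) (s' : S) : band z l s' ≤ 1 := by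
  unfold band
  split_ifs with h
  · exact (div_le_one (by positivity)).2 h.2.le
  · exact zero_le_one

/-- Above band 0 a nonzero rescaled value is at least 1/2, so first moments are controlled by second
moments. -/
theorem band_le_two_mul_sq {z : S → ℝ} {l : ℕ} (hl : l ≠ 0) (s' : S) :
    band z l s' ≤ 2 * band z l s' ^ 2 := by
  unfold band
  split_ifs with h
  · have h1 : 1 / 2 ≤ z s' / 2 ^ l := by
      rw [le_div_iff₀ (by positivity)]
      have := h.1.resolve_left hl
      linarith
    nlinarith
  · simp

theorem two_pow_mul_band (z : S → ℝ) (l : ℕ) (s' : S) :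
    2 ^ l * band z l s' = if (l = 0 ∨ (2 : ℝ) ^ l / 2 ≤ z s') ∧ z s' < 2 ^ l then z s' else 0 := by
  unfold band
  split_ifs
  · field_simp
  · rw [mul_zero]

/-- The bands have disjoint supports, so powers pass through the sum; p = 1 serves the mean and p =
2 the second moment. -/
theorem sum_band_pow (z : S → ℝ) {p : ℕ} (hp : p ≠ 0) (n : ℕ) (s' : S) :
    ∑ l ∈ Finset.range (n + 1), (2 ^ l * band z l s') ^ p =
      if z s' < 2 ^ n then z s' ^ p else 0 := by
  induction n with
  | zero =>
    rw [zero_add, Finset.sum_range_one, two_pow_mul_band]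
    simp [hp]
  | succ n ih =>
    rw [Finset.sum_range_succ, ih, two_pow_mul_band]
    have h1 : (2 : ℝ) ^ (n + 1) / 2 = 2 ^ n := by rw [pow_succ]; ring
    have h2 : (2 : ℝ) ^ n ≤ 2 ^ (n + 1) := pow_le_pow_right₀ one_le_two n.le_succ
    rw [h1]
    by_cases h : z s' < 2 ^ n
    · have h3 : ¬ ((n + 1 = 0 ∨ (2 : ℝ) ^ n ≤ z s') ∧ z s' < 2 ^ (n + 1)) := fun h' =>
        h'.1.elim (fun h => by omega) fun hle => absurd h (not_lt.2 hle)
      rw [if_pos h, if_neg h3, if_pos (h.trans_le h2), zero_pow hp, add_zero]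
    · rw [if_neg h, zero_add]
      by_cases h3 : z s' < 2 ^ (n + 1)
      · rw [if_pos ⟨Or.inr (not_lt.1 h), h3⟩, if_pos h3]
      · rw [if_neg fun h' => h3 h'.2, if_neg h3, zero_pow hp]

variable {A : Type*} [Fintype S] {M : MDP S A}

/-- The bands up to `2^n` carry the mean of `z` up to `2^{-n}`. -/
theorem abs_sum_mean_band_sub_le {z : S → ℝ} (hz : ∀ s', 0 ≤ z s') {s : S} {a : A}
    (hz2 : M.mean s a (fun s' => z s' ^ 2) ≤ 1) (n : ℕ) :
    |∑ l ∈ Finset.range (n + 1), 2 ^ l * M.mean s a (band z l) - M.mean s a z| ≤ 1 / 2 ^ n := by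
  have h1 : ∑ l ∈ Finset.range (n + 1), 2 ^ l * M.mean s a (band z l) =
      M.mean s a fun s' => if z s' < 2 ^ n then z s' else 0 := by
    rw [Finset.sum_congr rfl fun l _ => (MDP.mean_const_mul s a (2 ^ l) (band z l)).symm,
      ← MDP.mean_sum]
    congr 1
    funext s'
    simpa using sum_band_pow z one_ne_zero n s'
  rw [h1, abs_sub_comm, ← MDP.mean_sub, abs_of_nonneg]
  -- Where z ≥ 2^n one has z ≤ z²/2^n, so the discarded tail is paid for by the second moment.
  · calc M.mean s a (fun s' => z s' - if z s' < 2 ^ n then z s' else 0)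
        ≤ M.mean s a (fun s' => 1 / 2 ^ n * z s' ^ 2) := by
          refine MDP.mean_mono fun s' => ?_
          split_ifs with h
          · rw [sub_self]
            positivity
          · rw [not_lt] at h
            rw [sub_zero, one_div, ← div_eq_inv_mul, le_div_iff₀ (by positivity), sq]
            exact mul_le_mul_of_nonneg_left h (hz s')
      _ ≤ 1 / 2 ^ n := by
          rw [MDP.mean_const_mul]
          exact mul_le_of_le_one_right (by positivity) hz2
  · refine MDP.mean_nonneg fun s' => ?_
    split_ifs
    · rw [sub_self]
    · rw [sub_zero]
      exact hz s'

/-- Cauchy–Schwarz over the n + 1 bands. The squared terms sum to at most 3: twice the second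
moment, plus 1 for band 0, where the first moment is not controlled by the second. -/
theorem sum_two_pow_mul_sqrt_le {z : S → ℝ} (hz : ∀ s', 0 ≤ z s') {s : S} {a : A}
    (hz2 : M.mean s a (fun s' => z s' ^ 2) ≤ 1) (n : ℕ) :
    ∑ l ∈ Finset.range (n + 1), 2 ^ l * √(M.mean s a (band z l)) ≤ √3 * √(n + 1) := by
  have h1 : ∀ l, 0 ≤ M.mean s a (band z l) := fun l => MDP.mean_nonneg (band_nonneg hz l)
  have h2 : ∀ l ∈ Finset.range (n + 1), (2 ^ l * √(M.mean s a (band z l))) ^ 2 ≤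
      2 * M.mean s a (fun s' => (2 ^ l * band z l s') ^ 2) + if l = 0 then 1 else 0 := by
    intro l _
    rw [mul_pow, Real.sq_sqrt (h1 l)]
    simp_rw [mul_pow]
    rw [MDP.mean_const_mul]
    split_ifs with hl
    · have h3 : M.mean s a (band z l) ≤ 1 := MDP.mean_le (band_le_one z l)
      have h4 : 0 ≤ M.mean s a (fun s' => band z l s' ^ 2) :=
        MDP.mean_nonneg fun s' => sq_nonneg _
      subst hl
      simp only [pow_zero, one_pow, one_mul]
      linarith
    · have h3 : M.mean s a (band z l) ≤ 2 * M.mean s a (fun s' => band z l s' ^ 2) := by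
        rw [← MDP.mean_const_mul]
        exact MDP.mean_mono (band_le_two_mul_sq hl)
      have h4 : (0 : ℝ) ≤ (2 ^ l) ^ 2 := by positivity
      nlinarith
  have h3 : ∑ l ∈ Finset.range (n + 1), (2 ^ l * √(M.mean s a (band z l))) ^ 2 ≤ 3 := by
    refine (Finset.sum_le_sum h2).trans ?_
    rw [Finset.sum_add_distrib, ← Finset.mul_sum, ← MDP.mean_sum]
    have h4 : M.mean s a (fun s' => ∑ l ∈ Finset.range (n + 1), (2 ^ l * band z l s') ^ 2) ≤ 1 := by
      refine le_trans (MDP.mean_mono fun s' => ?_) hz2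
      rw [sum_band_pow z two_ne_zero]
      split_ifs
      · exact le_rfl
      · positivity
    have h5 : ∑ l ∈ Finset.range (n + 1), (if l = 0 then (1 : ℝ) else 0) = 1 := by simp
    linarith
  rw [← Real.sqrt_mul (by norm_num)]
  refine Real.le_sqrt_of_sq_le ?_
  refine (sq_sum_le_card_mul_sum_sq (s := Finset.range (n + 1))).trans ?_
  rw [Finset.card_range]
  push_cast
  nlinarith

end Bands

/-! ## Quantum mean estimation -/

section Estimation

variable {S A : Type*} [Fintype S] [DecidableEq S] [Fintype A] [DecidableEq A]
variable {M : MDP S A} {O : Oracle S A}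

/-- The states ψ are normalised, so the last register drops out and the next-state register has law
p(· | s, a). -/
theorem sum_oracle_born (hO : O.IsGenerativeModel M) (s : S) (a : A) (h : S → ℝ) :
    ∑ z : S × A × S × Fin O.J, h z.2.2.1 * ‖O.U.1 z (s, a, O.zero, 0)‖ ^ 2 = M.mean s a h := by
  obtain ⟨ψ, hψ, hU⟩ := hO
  simp only [Fintype.sum_prod_type, hU]
  rw [Finset.sum_eq_single s, Finset.sum_eq_single a]
  · refine Finset.sum_congr rfl fun s' _ => ?_
    have h1 : ∀ j,
        h s' * ‖if s = s ∧ a = a then (√(M.p s a s').toReal : ℂ) * ψ s' s a j else 0‖ ^ 2 =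
        h s' * (M.p s a s').toReal * ‖ψ s' s a j‖ ^ 2 := by
      intro j
      rw [if_pos ⟨rfl, rfl⟩, norm_mul, mul_pow, Complex.norm_real, Real.norm_eq_abs, sq_abs,
        Real.sq_sqrt ENNReal.toReal_nonneg, mul_assoc]
    rw [Finset.sum_congr rfl fun j _ => h1 j, ← Finset.mul_sum, hψ, mul_one, mul_comm]
  · intro a₁ _ ha
    simp [ha]
  · simp
  · intro s₁ _ hs
    simp [hs]
  · simp

theorem sum_estAmp_good (hO : O.IsGenerativeModel M) (s : S) (a : A) (w : S → unitInterval) :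
    ∑ x : Fin 2 × (S × A × S × Fin O.J) with x.1 = 1,
      ‖(controlled (fun x : S × A × S × Fin O.J => qubitRotation (w x.2.2.1)) * tensor 1 O.U :
        unitaryGroup (Fin 2 × (S × A × S × Fin O.J)) ℂ).1 x ((0 : Fin 2), (s, a, O.zero, 0))‖ ^ 2 =
      M.mean s a fun s' => (w s' : ℝ) := by
  have h1 : ∀ (i : Fin 2) (z : S × A × S × Fin O.J),
      (controlled (fun x : S × A × S × Fin O.J => qubitRotation (w x.2.2.1)) * tensor 1 O.U :
        unitaryGroup (Fin 2 × (S × A × S × Fin O.J)) ℂ).1 (i, z) ((0 : Fin 2), (s, a, O.zero, 0)) =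
      (qubitRotation (w z.2.2.1)).1 i 0 * O.U.1 z (s, a, O.zero, 0) := by
    intro i z
    change ((blockDiagonal fun x : S × A × S × Fin O.J => (qubitRotation (w x.2.2.1)).1) *
      ((1 : Matrix (Fin 2) (Fin 2) ℂ) ⊗ₖ O.U.1)) (i, z) (0, (s, a, O.zero, 0)) = _
    rw [Matrix.mul_apply, Finset.sum_eq_single (0, z)]
    · rw [blockDiagonal_apply_eq, kroneckerMap_apply, one_apply_eq, one_mul]
    · rintro ⟨i', z'⟩ _ hne
      by_cases hz : z = z'
      · subst hz
        have : i' ≠ 0 := fun h => hne (by rw [h])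
        rw [kroneckerMap_apply, one_apply_ne this, zero_mul, mul_zero]
      · rw [blockDiagonal_apply_ne _ _ _ hz, zero_mul]
    · simp
  rw [Finset.sum_filter, Fintype.sum_prod_type, Fin.sum_univ_two]
  simp only [zero_ne_one, if_false, Finset.sum_const_zero, zero_add, if_true, h1]
  rw [← sum_oracle_born hO]
  refine Finset.sum_congr rfl fun z _ => ?_
  have h2 : (qubitRotation (w z.2.2.1)).1 1 0 = (√(w z.2.2.1 : ℝ) : ℂ) := by
    simp [qubitRotation]
  rw [h2, norm_mul, mul_pow, Complex.norm_real, Real.norm_eq_abs, sq_abs,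
    Real.sq_sqrt (w z.2.2.1).2.1]

theorem failsLE_estAmp (hO : O.IsGenerativeModel M) (s : S) (a : A) (w : S → unitInterval)
    {t : ℕ} [NeZero t] (ht : 2 ≤ t) {μ : ℝ} (hμ : M.mean s a (fun s' => (w s' : ℝ)) = μ) :
    FailsLE (O.estAmp s a w t)
      (fun m => |m - μ| ≤ 2 * √(μ * (1 - μ)) * (Real.pi / t) + (Real.pi / t) ^ 2) (1 / 3) :=
  failsLE_ampEst _ _ _ ht ((sum_estAmp_good hO s a w).trans hμ)

theorem Oracle.sample_eq (hO : O.IsGenerativeModel M) (s : S) (a : A) :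
    O.sample s a = M.p s a := by
  ext s'
  rw [← PMF.toOuterMeasure_apply_singleton, Oracle.sample, PMF.toOuterMeasure_map_apply,
    PMF.toOuterMeasure_apply_fintype]
  have h1 := sum_oracle_born hO s a fun x => if x = s' then 1 else 0
  have h2 : M.mean s a (fun x => if x = s' then 1 else 0) = (M.p s a s').toReal := by
    simp [MDP.mean]
  rw [h2] at h1
  rw [← ENNReal.ofReal_toReal ((M.p s a).apply_ne_top s'), ← h1,
    ENNReal.ofReal_sum_of_nonneg fun _ _ => by positivity]
  refine Finset.sum_congr rfl fun z _ => ?_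
  by_cases hz : z.2.2.1 = s'
  · rw [Set.indicator_of_mem (by exact hz), if_pos hz, one_mul]
    rfl
  · rw [Set.indicator_of_notMem (by exact hz), if_neg hz]
    simp

theorem clamp_eq {x : ℝ} (h0 : 0 ≤ x) (h1 : x ≤ 1) : (clamp x : ℝ) = x := by
  rw [clamp, Set.projIcc_of_mem zero_le_one ⟨h0, h1⟩]

theorem one_third_eq_ofReal : (1 / 3 : ENNReal) = ENNReal.ofReal (1 / 3) := by
  rw [ENNReal.ofReal_div_of_pos (by norm_num)]
  simp

theorem two_mul_sqrt_mul_one_sub_le_one (μ : ℝ) : 2 * √(μ * (1 - μ)) ≤ 1 := by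
  have h : √(μ * (1 - μ)) ≤ 1 / 2 :=
    Real.sqrt_le_iff.2 ⟨by norm_num, by nlinarith [sq_nonneg (μ - 1 / 2)]⟩
  linarith

/-- Put x = u/e. From t ≥ 8x and t² ≥ 64x, the two terms of the amplitude estimation error, relative
to e/u, are at most π/8 and π²/64, whose sum is below 1. -/
theorem failsLE_qEst1 (hO : O.IsGenerativeModel M) (s : S) (a : A) {v : S → ℝ} {u e f : ℝ}
    (hu : 0 < u) (he : 0 < e) (hf : 0 < f) (hv0 : ∀ s', 0 ≤ v s') (hvu : ∀ s', v s' ≤ u) :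
    FailsLE (qEst1 O s a v u e f) (fun m => |m - M.mean s a v| ≤ e) (ENNReal.ofReal f) := by
  have hx : 0 < u / e := div_pos hu he
  have hs : 0 < √(u / e) := Real.sqrt_pos.2 hx
  set t : ℕ := ⌈8 * (u / e + √(u / e))⌉₊ + 1 with ht
  have ht2 : 2 ≤ t := by
    have : 0 < ⌈8 * (u / e + √(u / e))⌉₊ := Nat.ceil_pos.2 (by positivity)
    omega
  have htle : 8 * (u / e + √(u / e)) ≤ t := by
    rw [ht]
    push_cast
    linarith [Nat.le_ceil (8 * (u / e + √(u / e)))]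
  have hmean : M.mean s a (fun s' => (clamp (v s' / u) : ℝ)) = M.mean s a v / u := by
    rw [div_eq_inv_mul, ← MDP.mean_const_mul]
    congr 1
    funext s'
    rw [clamp_eq (div_nonneg (hv0 s') hu.le) ((div_le_one hu).2 (hvu s')), div_eq_inv_mul]
  have h1 := failsLE_estAmp hO s a (fun s' => clamp (v s' / u)) ht2 hmean
  refine failsLE_map.2 ((failsLE_powering hf h1).mono (fun m hm => ?_) le_rfl)
  set μ := M.mean s a v / u with hμ
  have h2 : u * m - M.mean s a v = u * (m - μ) := by
    rw [hμ]
    field_simp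
  rw [h2, abs_mul, abs_of_pos hu]
  have ht0 : (0 : ℝ) < t := by positivity
  have h3 := two_mul_sqrt_mul_one_sub_le_one μ
  have hpi := Real.pi_pos
  have hpi2 := Real.pi_lt_d2
  have h4 : |m - μ| ≤ Real.pi / t + (Real.pi / t) ^ 2 := by
    refine hm.trans (add_le_add ?_ le_rfl)
    exact mul_le_of_le_one_left (by positivity) h3
  have h5 : u / e * (Real.pi / t) ≤ Real.pi / 8 := by
    rw [mul_div_assoc', div_le_div_iff₀ ht0 (by norm_num)]
    nlinarith
  have h6 : u / e * (Real.pi / t) ^ 2 ≤ Real.pi ^ 2 / 64 := by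
    rw [div_pow, mul_div_assoc', div_le_div_iff₀ (by positivity) (by norm_num)]
    have h7 : 64 * (u / e) ≤ (t : ℝ) ^ 2 := by
      have h8 : 8 * √(u / e) ≤ t := by linarith
      have h9 := pow_le_pow_left₀ (by positivity) h8 2
      rw [mul_pow, Real.sq_sqrt hx.le] at h9
      linarith
    nlinarith [sq_nonneg Real.pi]
  have h7 : u / e * |m - μ| ≤ 1 := by
    refine (mul_le_mul_of_nonneg_left h4 hx.le).trans ?_
    nlinarith
  rw [div_mul_eq_mul_div, div_le_one he] at h7
  exact h7

/-- The error has three parts: truncation above 2^k (at most η/8), the linear terms (at most 0.18η,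
where the √(k+1) in t cancels that of Cauchy–Schwarz), and the quadratic terms (at most 0.08η).
Their sum is below η/2. -/
theorem failsLE_secondMomentEst (hO : O.IsGenerativeModel M) (s : S) (a : A) {z : S → ℝ} {η : ℝ}
    (hη : 0 < η) (hη1 : η < 1) (hz : ∀ s', 0 ≤ z s')
    (hz2 : M.mean s a (fun s' => z s' ^ 2) ≤ 1) :
    FailsLE (secondMomentEst O s a z η) (fun m => |m - M.mean s a z| ≤ η / 2)
      (ENNReal.ofReal (1 / 10)) := by
  unfold secondMomentEst
  set k := ⌈Real.logb 2 (8 / η)⌉₊ with hk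
  have hlog : 0 < Real.logb 2 (8 / η) :=
    Real.logb_pos one_lt_two ((one_lt_div hη).2 (by linarith))
  have h8η : (2 : ℝ) ^ Real.logb 2 (8 / η) = 8 / η :=
    Real.rpow_logb two_pos (by norm_num) (by positivity)
  have hk1 : 8 / η ≤ 2 ^ k := by
    rw [← h8η, ← Real.rpow_natCast]
    exact Real.rpow_le_rpow_of_exponent_le one_le_two (Nat.le_ceil _)
  have hk2 : (2 : ℝ) ^ k ≤ 16 / η := by
    have h1 : (2 : ℝ) ^ (k : ℝ) ≤ 2 ^ (Real.logb 2 (8 / η) + 1) :=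
      Real.rpow_le_rpow_of_exponent_le one_le_two (Nat.ceil_lt_add_one hlog.le).le
    rw [Real.rpow_add two_pos, h8η, Real.rpow_natCast, Real.rpow_one] at h1
    refine h1.trans_eq ?_
    ring
  set t : ℕ := ⌈64 * √((k : ℝ) + 1) / η⌉₊ + 1 with ht
  have hr0 : 0 < √((k : ℝ) + 1) := Real.sqrt_pos.2 (by positivity)
  have ht2 : 2 ≤ t := by
    have : 0 < ⌈64 * √((k : ℝ) + 1) / η⌉₊ := Nat.ceil_pos.2 (by positivity)
    omega
  have htle : 64 * √((k : ℝ) + 1) / η ≤ t := by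
    rw [ht]
    push_cast
    linarith [Nat.le_ceil (64 * √((k : ℝ) + 1) / η)]
  have hrun : ∀ l : Fin (k + 1), FailsLE (powering (1 / (10 * ((k : ℝ) + 1)))
      (O.estAmp s a (fun s' => clamp (band z l s')) t))
      (fun m => |m - M.mean s a (band z l)| ≤
        2 * √(M.mean s a (band z l) * (1 - M.mean s a (band z l))) * (Real.pi / t) +
          (Real.pi / t) ^ 2) (ENNReal.ofReal (1 / (10 * ((k : ℝ) + 1)))) := by
    intro l
    refine failsLE_powering (by positivity) (failsLE_estAmp hO s a _ ht2 ?_)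
    congr 1
    funext s'
    exact clamp_eq (band_nonneg hz l s') (band_le_one z l s')
  refine failsLE_map.2 ((failsLE_indep hrun).mono (fun x hx => ?_) (le_of_eq ?_))
  · have ht0 : (0 : ℝ) < t := by positivity
    set ρ := Real.pi / t with hρ
    have hpi := Real.pi_pos
    have hpi2 := Real.pi_lt_d2
    have hρ0 : 0 < ρ := by positivity
    have hρ1 : ρ * √((k : ℝ) + 1) ≤ Real.pi / 64 * η := by
      rw [div_le_iff₀ hη] at htle
      rw [hρ, div_mul_eq_mul_div, div_le_iff₀ ht0]
      nlinarith
    have hsum2 : ∀ y : ℕ → ℝ, ∑ l : Fin (k + 1), y l = ∑ l ∈ Finset.range (k + 1), y l :=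
      fun y => Fin.sum_univ_eq_sum_range y (k + 1)
    have h1 : |∑ l : Fin (k + 1), 2 ^ (l : ℕ) * x l -
        ∑ l : Fin (k + 1), 2 ^ (l : ℕ) * M.mean s a (band z l)| ≤
        ∑ l : Fin (k + 1), 2 ^ (l : ℕ) * (2 * √(M.mean s a (band z l)) * ρ + ρ ^ 2) := by
      rw [← Finset.sum_sub_distrib]
      refine (Finset.abs_sum_le_sum_abs _ _).trans (Finset.sum_le_sum fun l _ => ?_)
      rw [← mul_sub, abs_mul, abs_of_pos (by positivity : (0 : ℝ) < 2 ^ (l : ℕ))]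
      refine mul_le_mul_of_nonneg_left ((hx l).trans ?_) (by positivity)
      have h0 : 0 ≤ M.mean s a (band z l) := MDP.mean_nonneg (band_nonneg hz l)
      have : √(M.mean s a (band z l) * (1 - M.mean s a (band z l))) ≤ √(M.mean s a (band z l)) :=
        Real.sqrt_le_sqrt (mul_le_of_le_one_right h0 (by linarith))
      gcongr
    rw [hsum2 fun l => 2 ^ l * M.mean s a (band z l),
      hsum2 fun l => 2 ^ l * (2 * √(M.mean s a (band z l)) * ρ + ρ ^ 2)] at h1
    have h2 := abs_sum_mean_band_sub_le hz hz2 k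
    have h3 : ∑ l ∈ Finset.range (k + 1), (2 : ℝ) ^ l * (2 * √(M.mean s a (band z l)) * ρ + ρ ^ 2) =
        2 * ρ * (∑ l ∈ Finset.range (k + 1), 2 ^ l * √(M.mean s a (band z l))) +
          ρ ^ 2 * ∑ l ∈ Finset.range (k + 1), (2 : ℝ) ^ l := by
      rw [Finset.mul_sum, Finset.mul_sum, ← Finset.sum_add_distrib]
      exact Finset.sum_congr rfl fun l _ => by ring
    have h4 := sum_two_pow_mul_sqrt_le hz hz2 k
    have h5 : ∑ l ∈ Finset.range (k + 1), (2 : ℝ) ^ l ≤ 32 / η := by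
      rw [geom_sum_eq (by norm_num), pow_succ]
      have : (32 : ℝ) / η = 2 * (16 / η) := by ring
      linarith
    have h6 : (1 : ℝ) / 2 ^ k ≤ η / 8 := by
      rw [div_le_div_iff₀ (by positivity) (by norm_num)]
      rw [div_le_iff₀ hη] at hk1
      linarith
    have hs3 : √3 ≤ 1.75 := Real.sqrt_le_iff.2 ⟨by norm_num, by norm_num⟩
    have h7 : 2 * ρ * (∑ l ∈ Finset.range (k + 1), 2 ^ l * √(M.mean s a (band z l))) ≤
        0.18 * η := by
      calc _ ≤ 2 * ρ * (1.75 * √((k : ℝ) + 1)) := by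
            refine mul_le_mul_of_nonneg_left (h4.trans ?_) (by positivity)
            gcongr
        _ = 3.5 * (ρ * √((k : ℝ) + 1)) := by ring
        _ ≤ 3.5 * (Real.pi / 64 * η) := by gcongr
        _ ≤ 0.18 * η := by nlinarith
    have h8 : ρ ^ 2 * ∑ l ∈ Finset.range (k + 1), (2 : ℝ) ^ l ≤ 0.08 * η := by
      have hr1 : 1 ≤ √((k : ℝ) + 1) := Real.one_le_sqrt.2 (by linarith [Nat.cast_nonneg (α := ℝ) k])
      have hρ2 : ρ ≤ Real.pi / 64 * η := (le_mul_of_one_le_right hρ0.le hr1).trans hρ1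
      calc _ ≤ (Real.pi / 64 * η) ^ 2 * (32 / η) := by gcongr
        _ = Real.pi ^ 2 * (1 / 128) * η := by
            field_simp
            ring
        _ ≤ 0.08 * η := by
            refine mul_le_mul_of_nonneg_right ?_ hη.le
            nlinarith
    have h9 := abs_sub_le (∑ l : Fin (k + 1), 2 ^ (l : ℕ) * x l)
      (∑ l ∈ Finset.range (k + 1), 2 ^ l * M.mean s a (band z l)) (M.mean s a z)
    rw [h3] at h1
    linarith
  -- Each of the k + 1 bands fails with probability at most 1/(10(k+1)).
  · rw [Fintype.card_fin, ← ENNReal.ofReal_natCast, ← ENNReal.ofReal_mul (by positivity)]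
    congr 1
    push_cast
    field_simp

/-- Chebyshev's inequality for a sample of the next state. -/
theorem failsLE_sample (hO : O.IsGenerativeModel M) (s : S) (a : A) {v : S → ℝ} {σ : ℝ}
    (hσ : 0 < σ) (hv : M.mean s a (fun s' => (v s' - M.mean s a v) ^ 2) ≤ σ ^ 2) :
    FailsLE (O.sample s a) (fun s₀ => (M.mean s a v - v s₀) ^ 2 ≤ 15 * σ ^ 2)
      (ENNReal.ofReal (1 / 15)) := by
  classical
  rw [FailsLE, Oracle.sample_eq hO]
  set F : Finset S := Finset.univ.filter fun s₀ => ¬ (M.mean s a v - v s₀) ^ 2 ≤ 15 * σ ^ 2 with hF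
  have hset : {s₀ | ¬ (M.mean s a v - v s₀) ^ 2 ≤ 15 * σ ^ 2} = (F : Set S) := by
    ext
    simp [hF]
  rw [hset, PMF.toOuterMeasure_apply_finset,
    Finset.sum_congr rfl fun s' _ => (ENNReal.ofReal_toReal ((M.p s a).apply_ne_top s')).symm,
    ← ENNReal.ofReal_sum_of_nonneg fun _ _ => ENNReal.toReal_nonneg]
  refine ENNReal.ofReal_le_ofReal ?_
  have h1 : (∑ s' ∈ F, (M.p s a s').toReal) * (15 * σ ^ 2) ≤ σ ^ 2 := by
    refine le_trans ?_ hv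
    rw [Finset.sum_mul]
    calc ∑ s' ∈ F, (M.p s a s').toReal * (15 * σ ^ 2)
        ≤ ∑ s' ∈ F, (M.p s a s').toReal * (v s' - M.mean s a v) ^ 2 := by
          refine Finset.sum_le_sum fun s' hs' => mul_le_mul_of_nonneg_left ?_ ENNReal.toReal_nonneg
          have := (Finset.mem_filter.1 hs').2
          nlinarith
      _ ≤ _ := Finset.sum_le_sum_of_subset_of_nonneg (Finset.subset_univ _) fun s' _ _ =>
          mul_nonneg ENNReal.toReal_nonneg (sq_nonneg _)
  have h2 : 0 < σ ^ 2 := by positivity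
  nlinarith

theorem failsLE_qEst2Run (hO : O.IsGenerativeModel M) (s : S) (a : A) {v : S → ℝ} {σ e : ℝ}
    (he : 0 < e) (heσ : e < 4 * σ)
    (hv : M.mean s a (fun s' => (v s' - M.mean s a v) ^ 2) ≤ σ ^ 2) :
    FailsLE (qEst2Run O s a v σ e) (fun m => |m - M.mean s a v| ≤ e) (1 / 3) := by
  have hσ4 : 0 < 4 * σ := he.trans heσ
  have hσ : 0 < σ := by linarith
  have hη : 0 < e / (4 * σ) := div_pos he hσ4
  have hη1 : e / (4 * σ) < 1 := (div_lt_one hσ4).2 heσ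
  -- The sample costs 1/15 and each of the two mean estimates 1/10; the final 1/15 is slack.
  have hthird : (1 / 3 : ENNReal) = ENNReal.ofReal (1 / 15) +
      (ENNReal.ofReal (1 / 10) + (ENNReal.ofReal (1 / 10) + ENNReal.ofReal (1 / 15))) := by
    rw [one_third_eq_ofReal, ← ENNReal.ofReal_add (by norm_num) (by norm_num),
      ← ENNReal.ofReal_add (by norm_num) (by norm_num),
      ← ENNReal.ofReal_add (by norm_num) (by norm_num)]
    norm_num
  rw [hthird]
  refine (failsLE_sample hO s a hσ hv).bind fun s₀ hs₀ => ?_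
  set z : S → ℝ := fun s' => (v s' - v s₀) / (4 * σ) with hzdef
  -- The second moment about v[s₀] is the variance plus the squared distance of v[s₀] from the mean,
  -- at most σ² + 15σ² = (4σ)². This is why Chebyshev is used with 15 and z is scaled by 4σ.
  have hz2 : M.mean s a (fun s' => z s' ^ 2) ≤ 1 := by
    have h1 : (fun s' => z s' ^ 2) = fun s' => ((4 * σ) ^ 2)⁻¹ * (v s' - v s₀) ^ 2 := by
      funext s'
      rw [hzdef]
      simp only
      rw [div_pow, div_eq_inv_mul]
    rw [h1, MDP.mean_const_mul, MDP.mean_sq_sub, ← div_eq_inv_mul, div_le_one (by positivity)]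
    linarith
  have hzm : M.mean s a z = (M.mean s a v - v s₀) / (4 * σ) := by
    have h1 : z = fun s' => (4 * σ)⁻¹ * (v s' - v s₀) := by
      funext s'
      exact div_eq_inv_mul _ _
    rw [h1, MDP.mean_const_mul, MDP.mean_sub, MDP.mean_const, div_eq_inv_mul]
  have hpos : M.mean s a (fun s' => max (z s') 0 ^ 2) ≤ 1 := by
    refine le_trans (MDP.mean_mono fun s' => ?_) hz2
    rcases max_cases (z s') 0 with h | h
    · rw [h.1]
    · rw [h.1, zero_pow two_ne_zero]
      exact sq_nonneg _
  have hneg : M.mean s a (fun s' => max (-z s') 0 ^ 2) ≤ 1 := by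
    refine le_trans (MDP.mean_mono fun s' => ?_) hz2
    rcases max_cases (-z s') 0 with h | h
    · rw [h.1, neg_sq]
    · rw [h.1, zero_pow two_ne_zero]
      exact sq_nonneg _
  have hdiff : M.mean s a (fun s' => max (z s') 0) - M.mean s a (fun s' => max (-z s') 0) =
      M.mean s a z := by
    rw [← MDP.mean_sub]
    congr 1
    funext s'
    exact max_zero_sub_max_neg_zero_eq_self (z s')
  refine (failsLE_secondMomentEst hO s a hη hη1 (fun _ => le_max_right _ _) hpos).bind
    fun x hx => failsLE_map.2 ?_
  refine (failsLE_secondMomentEst hO s a hη hη1 (fun _ => le_max_right _ _) hneg).mono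
    (fun y hy => ?_) le_self_add
  have h1 : v s₀ + 4 * σ * (x - y) - M.mean s a v =
      4 * σ * ((x - M.mean s a fun s' => max (z s') 0) -
        (y - M.mean s a fun s' => max (-z s') 0)) := by
    have h2 : M.mean s a v = v s₀ + 4 * σ * (M.mean s a (fun s' => max (z s') 0) -
        M.mean s a (fun s' => max (-z s') 0)) := by
      rw [hdiff, hzm]
      field_simp
      ring
    rw [h2]
    ring
  rw [h1, abs_mul, abs_of_pos hσ4]
  have h2 := (abs_sub (x - M.mean s a fun s' => max (z s') 0)
    (y - M.mean s a fun s' => max (-z s') 0)).trans (add_le_add hx hy)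
  rw [add_halves, le_div_iff₀ hσ4, mul_comm] at h2
  exact h2

theorem failsLE_qEst2 (hO : O.IsGenerativeModel M) (s : S) (a : A) {v : S → ℝ} {σ e f : ℝ}
    (he : 0 < e) (heσ : e < 4 * σ) (hf : 0 < f)
    (hv : M.mean s a (fun s' => (v s' - M.mean s a v) ^ 2) ≤ σ ^ 2) :
    FailsLE (qEst2 O s a v σ e f) (fun m => |m - M.mean s a v| ≤ e) (ENNReal.ofReal f) :=
  failsLE_powering hf (failsLE_qEst2Run hO s a he heσ hv)

end Estimation

/-! ## Parameters -/

section Parameters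

variable {S A : Type*} (M : MDP S A)

theorem MDP.horizon_pos : 0 < horizon M.γ := one_pos.trans_le M.one_le_horizon

theorem MDP.one_sub_γ_pos : 0 < 1 - M.γ := sub_pos.2 M.γ_lt_one

theorem MDP.one_sub_mul_horizon : (1 - M.γ) * horizon M.γ = 1 :=
  mul_inv_cancel₀ M.one_sub_γ_pos.ne'

/-- Makes all later estimates polynomial in g = √Γ. -/
theorem MDP.rpow_one_sub : (1 - M.γ) ^ (3 / 2 : ℝ) = (√(horizon M.γ) ^ 3)⁻¹ := by
  have h := M.one_sub_γ_pos
  rw [horizon, Real.sqrt_inv, inv_pow, inv_inv, Real.sqrt_eq_rpow, ← Real.rpow_natCast,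
    ← Real.rpow_mul h.le]
  norm_num

theorem MDP.accuracy_pos {ε : ℝ} (hε : 0 < ε) : 0 < paramC * (1 - M.γ) ^ (3 / 2 : ℝ) * ε :=
  mul_pos (mul_pos (by norm_num [paramC]) (Real.rpow_pos_of_pos M.one_sub_γ_pos _)) hε

theorem MDP.accuracy_lt_one {ε : ℝ} (hεΓ : ε ≤ √(horizon M.γ)) :
    paramC * (1 - M.γ) ^ (3 / 2 : ℝ) * ε < 1 := by
  have hg : 1 ≤ √(horizon M.γ) := Real.one_le_sqrt.2 M.one_le_horizon
  rw [M.rpow_one_sub, paramC]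
  set g := √(horizon M.γ)
  have h1 : (g ^ 3)⁻¹ * ε ≤ 1 := by
    rw [← div_eq_inv_mul, div_le_one (by positivity)]
    exact hεΓ.trans (le_self_pow₀ hg (by norm_num))
  nlinarith

/-- From γ ≤ exp(-(1-γ)) and (1-γ)(L-1) ≥ ln(4Γ/ε) the power is at most ε/(4Γ). The exponent is L -
1 because v lags one iteration behind q. -/
theorem MDP.pow_epochLength_le {ε : ℝ} (hε : 0 < ε) (hεΓ : ε ≤ √(horizon M.γ)) :
    M.γ ^ (epochLength M.γ ε - 1) ≤ 1 / 4 := by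
  have hΓ := M.horizon_pos
  have hγ := M.one_sub_γ_pos
  rw [epochLength, Nat.add_sub_cancel]
  set m := ⌈Real.log (4 * horizon M.γ / ε)⌉₊
  set n := ⌈horizon M.γ * (m : ℝ)⌉₊
  have h1 : M.γ ≤ Real.exp (-(1 - M.γ)) := by
    have := Real.add_one_le_exp (-(1 - M.γ))
    linarith
  have h2 : Real.log (4 * horizon M.γ / ε) ≤ m := Nat.le_ceil _
  have h3 : horizon M.γ * (m : ℝ) ≤ n := Nat.le_ceil _
  have h4 : (m : ℝ) ≤ (1 - M.γ) * n := by
    calc (m : ℝ) = (1 - M.γ) * (horizon M.γ * m) := by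
          rw [← mul_assoc, M.one_sub_mul_horizon, one_mul]
      _ ≤ _ := mul_le_mul_of_nonneg_left h3 hγ.le
  have h5 : ε ≤ horizon M.γ := by
    refine hεΓ.trans (Real.sqrt_le_iff.2 ⟨hΓ.le, ?_⟩)
    have := M.one_le_horizon
    nlinarith
  calc M.γ ^ n ≤ Real.exp (-(1 - M.γ)) ^ n := pow_le_pow_left₀ M.γ_nonneg h1 n
    _ = Real.exp (-((1 - M.γ) * n)) := by
        rw [← Real.exp_nat_mul]
        congr 1
        ring
    _ ≤ Real.exp (-Real.log (4 * horizon M.γ / ε)) := Real.exp_le_exp.2 (by linarith)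
    _ = ε / (4 * horizon M.γ) := by
        rw [← Real.log_inv, Real.exp_log (by positivity), inv_div]
    _ ≤ 1 / 4 := by
        rw [div_le_div_iff₀ (by positivity) (by norm_num)]
        linarith

theorem MDP.epochError_pos (k : ℕ) : 0 < epochError M.γ k := div_pos M.horizon_pos (by positivity)

theorem epochError_eq_two_mul (γ : ℝ) (k : ℕ) : epochError γ k = 2 * epochError γ (k + 1) := by
  rw [epochError, epochError, pow_succ]
  field_simp

/-- Every epoch that is run starts with a target still at least ε, so error terms proportional to ε
can be charged to it. -/
theorem MDP.le_epochError {ε : ℝ} (hε : 0 < ε) {k : ℕ} (hk : k < numEpochs M.γ ε) :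
    ε ≤ epochError M.γ k := by
  have hΓ := M.horizon_pos
  have h1 : (k : ℝ) < Real.logb 2 (horizon M.γ / ε) := Nat.lt_ceil.1 hk
  rw [Real.lt_logb_iff_rpow_lt one_lt_two (by positivity), Real.rpow_natCast, lt_div_iff₀ hε] at h1
  rw [epochError, le_div_iff₀ (by positivity)]
  linarith

theorem MDP.epochError_numEpochs_le {ε : ℝ} (hε : 0 < ε) :
    epochError M.γ (numEpochs M.γ ε) ≤ ε := by
  have hΓ := M.horizon_pos
  have h1 : Real.logb 2 (horizon M.γ / ε) ≤ numEpochs M.γ ε := Nat.le_ceil _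
  rw [Real.logb_le_iff_le_rpow one_lt_two (by positivity), Real.rpow_natCast, div_le_iff₀ hε] at h1
  rw [epochError, div_le_iff₀ (by positivity)]
  linarith

end Parameters

/-! ## Variances -/

section Variance

variable {S A : Type*} [Fintype S]

/-- The variance of `u[s']`, `s' ∼ p(· | s, a)`. -/
def MDP.var (M : MDP S A) (s : S) (a : A) (u : S → ℝ) : ℝ :=
  M.mean s a fun s' => (u s' - M.mean s a u) ^ 2

variable {M : MDP S A}

theorem MDP.var_nonneg (s : S) (a : A) (u : S → ℝ) : 0 ≤ M.var s a u :=
  MDP.mean_nonneg fun _ => sq_nonneg _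

theorem MDP.var_eq (s : S) (a : A) (u : S → ℝ) :
    M.var s a u = M.mean s a (fun s' => u s' ^ 2) - M.mean s a u ^ 2 := by
  have h := M.mean_sq_sub s a u 0
  simp only [sub_zero] at h
  rw [MDP.var, h]
  ring

/-- The mean minimises the second moment, so recentre u at the mean of w and use (x + y)² ≤ 2x² +
2y². -/
theorem MDP.var_le_of_close {s : S} {a : A} {u w : S → ℝ} {B : ℝ} (h : ∀ s', |u s' - w s'| ≤ B) :
    M.var s a u ≤ 2 * M.var s a w + 2 * B ^ 2 := by
  have h1 : M.var s a u ≤ M.mean s a fun s' => (u s' - M.mean s a w) ^ 2 := by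
    rw [M.mean_sq_sub, MDP.var]
    linarith [sq_nonneg (M.mean s a u - M.mean s a w)]
  refine h1.trans ?_
  rw [MDP.var, ← MDP.mean_const_mul, ← M.mean_const s a (2 * B ^ 2), ← MDP.mean_add]
  refine MDP.mean_mono fun s' => ?_
  have h2 := sq_le_sq' (abs_le.1 (h s')).1 (abs_le.1 (h s')).2
  nlinarith [sq_nonneg ((u s' - w s') - (w s' - M.mean s a w))]

variable (M) [Fintype A] [Nonempty A]

/-- The discounted variance of the optimal values decreases the potential `2 Γ² - q*²`. -/
theorem MDP.var_optValue_add_le {σ : S → A} (hσ : ∀ s, M.optValue s ≤ M.optQValue s (σ s)) (s : S)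
    (a : A) :
    M.γ ^ 2 * M.var s a M.optValue +
      M.γ * M.mean s a (fun s' => 2 * horizon M.γ ^ 2 - M.optQValue s' (σ s') ^ 2) ≤
      2 * horizon M.γ ^ 2 - M.optQValue s a ^ 2 := by
  have hγ := M.γ_nonneg
  have hγ1 := M.γ_lt_one
  have h1 : M.mean s a (fun s' => M.optValue s' ^ 2) ≤
      M.mean s a (fun s' => M.optQValue s' (σ s') ^ 2) :=
    MDP.mean_mono fun s' => pow_le_pow_left₀ (M.optValue_nonneg s') (hσ s') 2
  have h2 : 0 ≤ M.mean s a (fun s' => M.optQValue s' (σ s') ^ 2) :=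
    MDP.mean_nonneg fun _ => sq_nonneg _
  -- Square q* - r ≤ γPv*; the cross term 2q*r is at most 2Γ. If q* < r the left side is already
  -- nonpositive, since q*² ≤ q*r ≤ Γ.
  have h3 : M.optQValue s a ^ 2 - 2 * horizon M.γ ≤ (M.γ * M.mean s a M.optValue) ^ 2 := by
    have h4 := M.optQValue_le s a
    have h5 := M.optQValue_le_horizon s a
    have h6 := M.optQValue_nonneg s a
    have h7 := M.r_nonneg s a
    have h8 := M.r_le_one s a
    have h9 : M.optQValue s a * M.r s a ≤ horizon M.γ * 1 := mul_le_mul h5 h8 h7 (h6.trans h5)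
    by_cases h : M.r s a ≤ M.optQValue s a
    · have h10 : (M.optQValue s a - M.r s a) ^ 2 ≤ (M.γ * M.mean s a M.optValue) ^ 2 :=
        pow_le_pow_left₀ (by linarith) (by linarith) 2
      nlinarith
    · nlinarith [sq_nonneg (M.γ * M.mean s a M.optValue)]
  -- The loss 2Γ is exactly 2Γ²(1-γ), which fixes the constant 2Γ² in the potential.
  have hΓ : horizon M.γ ^ 2 * (1 - M.γ) = horizon M.γ := by
    rw [sq, mul_assoc, mul_comm (horizon M.γ) (1 - M.γ), M.one_sub_mul_horizon, mul_one]
  rw [MDP.var_eq, MDP.mean_sub, MDP.mean_const]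
  have h11 : M.γ ^ 2 * M.mean s a (fun s' => M.optValue s' ^ 2) ≤
      M.γ * M.mean s a (fun s' => M.optQValue s' (σ s') ^ 2) := by
    calc _ ≤ M.γ ^ 2 * M.mean s a (fun s' => M.optQValue s' (σ s') ^ 2) := by gcongr
      _ ≤ _ := mul_le_mul_of_nonneg_right (by nlinarith) h2
  nlinarith

/-- A bound for the accumulated error of an epoch: `γ` times the error of one step is absorbed by
the decrease of `H` along the policy `σ`. -/
theorem MDP.exists_error_potential {ε B : ℝ} (hε : 0 < ε) (hεΓ : ε ≤ √(horizon M.γ)) (hεB : ε ≤ B)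
    {σ : S → A} (hσ : ∀ s, M.optValue s ≤ M.optQValue s (σ s)) :
    ∃ H : S → A → ℝ, (∀ s a, 0 ≤ H s a) ∧ (∀ s a, H s a ≤ B / 4) ∧
      ∀ (v₀ : S → ℝ), (∀ s, |v₀ s - M.optValue s| ≤ B) → ∀ s a,
        M.γ * (2 * (paramC * (1 - M.γ) ^ (3 / 2 : ℝ) * ε * √(M.var s a v₀ + 5)) +
          paramC * (1 - M.γ) * B) + M.γ * M.mean s a (fun s' => H s' (σ s')) ≤ H s a := by
  have hΓ1 := M.one_le_horizon
  have hγ := M.γ_nonneg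
  have hγ1 := M.γ_lt_one
  have hB : 0 < B := hε.trans_le hεB
  have hG := M.one_sub_mul_horizon
  have hα : 0 < paramC * (1 - M.γ) ^ (3 / 2 : ℝ) * ε := M.accuracy_pos hε
  have hα' : paramC * (1 - M.γ) ^ (3 / 2 : ℝ) * ε = paramC * (√(horizon M.γ) ^ 3)⁻¹ * ε := by
    rw [M.rpow_one_sub]
  set α := 2 * (paramC * (1 - M.γ) ^ (3 / 2 : ℝ) * ε) with hαdef
  have hα0 : 0 < α := by positivity
  set g := √(horizon M.γ) with hg
  have hg1 : 1 ≤ g := Real.one_le_sqrt.2 hΓ1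
  have hg2 : horizon M.γ = g ^ 2 := (Real.sq_sqrt (by linarith)).symm
  have hαg : α * g ^ 3 = 0.02 * ε := by
    rw [hαdef, hα', paramC]
    field_simp
    norm_num
  -- The part of the step error not covered by the variance: the AM–GM remainder g/2, the passage
  -- from Var(v₀) + 5 to Var(v*), and the error of Δ. A constant κ per step accumulates to Γκ.
  set κ := α * (g / 2 + 1.5 * B + 2.5) + paramC * (1 - M.γ) * B with hκ
  have hc : 0 < paramC * (1 - M.γ) * B :=
    mul_pos (mul_pos (by norm_num [paramC]) M.one_sub_γ_pos) hB
  have hκ0 : 0 < κ := by positivity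
  have hΨ0 : ∀ s a, 0 ≤ 2 * horizon M.γ ^ 2 - M.optQValue s a ^ 2 := by
    intro s a
    have := pow_le_pow_left₀ (M.optQValue_nonneg s a) (M.optQValue_le_horizon s a) 2
    nlinarith [sq_nonneg (horizon M.γ)]
  refine ⟨fun s a => α / g * (2 * horizon M.γ ^ 2 - M.optQValue s a ^ 2) + horizon M.γ * κ,
    fun s a => ?_, fun s a => ?_, fun v₀ hv₀ s a => ?_⟩
  · have := hΨ0 s a
    positivity
  · have h1 : α / g * (2 * horizon M.γ ^ 2 - M.optQValue s a ^ 2) ≤ 0.04 * ε := by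
      calc _ ≤ α / g * (2 * horizon M.γ ^ 2) := by
            refine mul_le_mul_of_nonneg_left ?_ (by positivity)
            linarith [sq_nonneg (M.optQValue s a)]
        _ = 2 * (α * g ^ 3) := by
            rw [hg2]
            field_simp
        _ = 0.04 * ε := by
            rw [hαg]
            ring
    have h2 : horizon M.γ * (paramC * (1 - M.γ) * B) = 0.01 * B := by
      rw [paramC]
      linear_combination (0.01 * B) * hG
    have h3 : horizon M.γ * (α * (g / 2)) = 0.01 * ε := by
      rw [hg2]
      linear_combination hαg / 2
    -- Here ε ≤ √Γ enters: it keeps 1.5Bαg² a small fraction of B. Altogether H ≤ 0.1ε + 0.04B,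
    -- within B/4 as ε ≤ B.
    have h4 : α * g ^ 2 ≤ 0.02 := by
      have : α * g ^ 2 * g ≤ 0.02 * g := by
        calc α * g ^ 2 * g = 0.02 * ε := by linear_combination hαg
          _ ≤ 0.02 * g := by gcongr
      exact le_of_mul_le_mul_right this (by linarith)
    have h5 : α * g ^ 2 ≤ 0.02 * ε := by
      refine le_trans ?_ hαg.le
      gcongr
      norm_num
    have h6 : horizon M.γ * κ = horizon M.γ * (α * (g / 2)) + 1.5 * B * (α * g ^ 2) +
        2.5 * (α * g ^ 2) + horizon M.γ * (paramC * (1 - M.γ) * B) := by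
      rw [hκ, hg2]
      ring
    rw [h6, h2, h3]
    nlinarith
  · have hV := MDP.var_nonneg (M := M) s a M.optValue
    -- Uses √2 ≤ 1.5 and √5 ≤ 2.5.
    have h1 : √(M.var s a v₀ + 5) ≤ √(2 * M.var s a M.optValue) + (1.5 * B + 2.5) := by
      have h3 := MDP.var_le_of_close (M := M) (s := s) (a := a) hv₀
      have h4 := Real.sq_sqrt (show 0 ≤ 2 * M.var s a M.optValue by positivity)
      have h5 := Real.sqrt_nonneg (2 * M.var s a M.optValue)
      exact Real.sqrt_le_iff.2 ⟨by positivity, by nlinarith⟩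
    -- AM–GM with weight g = √Γ: the variance term accumulates to at most 2Γ²/g and the remainder to
    -- Γg/2, both of order Γ^{3/2}.
    have h2 : M.γ * √(2 * M.var s a M.optValue) ≤
        M.γ ^ 2 * M.var s a M.optValue / g + g / 2 := by
      have h3 := Real.sq_sqrt (show 0 ≤ 2 * M.var s a M.optValue by positivity)
      set y := √(2 * M.var s a M.optValue)
      have h4 : M.γ ^ 2 * M.var s a M.optValue / g + g / 2 - M.γ * y =
          (M.γ * y - g) ^ 2 / (2 * g) := by
        have : M.var s a M.optValue = y ^ 2 / 2 := by linarith
        rw [this]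
        field_simp
        ring
      have h5 : 0 ≤ (M.γ * y - g) ^ 2 / (2 * g) := by positivity
      linarith
    have h3 : M.γ * √(M.var s a v₀ + 5) ≤
        M.γ ^ 2 * M.var s a M.optValue / g + (g / 2 + 1.5 * B + 2.5) := by
      have h4 := mul_le_mul_of_nonneg_left h1 hγ
      have h5 : M.γ * (1.5 * B + 2.5) ≤ 1.5 * B + 2.5 :=
        mul_le_of_le_one_left (by positivity) hγ1.le
      linarith
    have h4 : M.γ * (2 * (paramC * (1 - M.γ) ^ (3 / 2 : ℝ) * ε * √(M.var s a v₀ + 5)) +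
          paramC * (1 - M.γ) * B) ≤ α / g * (M.γ ^ 2 * M.var s a M.optValue) + κ := by
      have h5 := mul_le_mul_of_nonneg_left h3 hα0.le
      have h6 : M.γ * (paramC * (1 - M.γ) * B) ≤ paramC * (1 - M.γ) * B :=
        mul_le_of_le_one_left hc.le hγ1.le
      have h7 : α / g * (M.γ ^ 2 * M.var s a M.optValue) =
        α * (M.γ ^ 2 * M.var s a M.optValue / g) := by ring
      rw [h7, hκ]
      rw [hαdef] at h5 ⊢
      linarith
    have h5 := mul_le_mul_of_nonneg_left (M.var_optValue_add_le hσ s a)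
      (show 0 ≤ α / g by positivity)
    have h6 : M.mean s a (fun s' => α / g * (2 * horizon M.γ ^ 2 - M.optQValue s' (σ s') ^ 2) +
        horizon M.γ * κ) = α / g * M.mean s a (fun s' => 2 * horizon M.γ ^ 2 -
          M.optQValue s' (σ s') ^ 2) + horizon M.γ * κ := by
      rw [MDP.mean_add, MDP.mean_const_mul, MDP.mean_const]
    have h7 : κ + M.γ * (horizon M.γ * κ) = horizon M.γ * κ := by
      linear_combination (-κ) * hG
    rw [h6]
    linarith

end Variance

/-! ## Correctness of the algorithm -/

section Algorithm

variable {S A : Type*} [Fintype S] [DecidableEq S] [Fintype A] [DecidableEq A]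
variable {M : MDP S A} {O : Oracle S A}

omit [DecidableEq S] [Fintype A] [DecidableEq A] in
-- The second moment contributes error 1 and the squared mean at most (2Pv₀ + (1-γ))(1-γ) ≤ 3, since
-- Pv₀ ≤ Γ. Truncation at 0 is harmless because the variance is nonnegative.
theorem abs_max_sub_var_le {v₀ : S → ℝ} (hv0 : ∀ s, 0 ≤ v₀ s) (hvΓ : ∀ s, v₀ s ≤ horizon M.γ)
    {s : S} {a : A} {m₁ m₂ : ℝ} (hm₂ : |m₂ - M.mean s a (fun s' => v₀ s' ^ 2)| ≤ 1)
    (hm₁ : |m₁ - M.mean s a v₀| ≤ 1 - M.γ) : |max (m₂ - m₁ ^ 2) 0 - M.var s a v₀| ≤ 4 := by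
  have hγ := M.one_sub_γ_pos
  have hγ0 := M.γ_nonneg
  have hV0 := MDP.var_nonneg (M := M) s a v₀
  have hm0 : 0 ≤ M.mean s a v₀ := MDP.mean_nonneg hv0
  have hmΓ : (1 - M.γ) * M.mean s a v₀ ≤ 1 :=
    (mul_le_mul_of_nonneg_left (MDP.mean_le hvΓ) hγ.le).trans_eq M.one_sub_mul_horizon
  have hvar := MDP.var_eq (M := M) s a v₀
  have hsq : |m₁ ^ 2 - M.mean s a v₀ ^ 2| ≤ 3 := by
    have h1 : |m₁ + M.mean s a v₀| ≤ 2 * M.mean s a v₀ + (1 - M.γ) := by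
      rw [abs_le] at hm₁ ⊢
      constructor <;> linarith
    rw [sq_sub_sq, abs_mul]
    calc _ ≤ (2 * M.mean s a v₀ + (1 - M.γ)) * (1 - M.γ) := by gcongr
      _ ≤ 3 := by nlinarith
  rw [abs_le] at hm₂ hsq ⊢
  constructor
  · linarith [le_max_left (m₂ - m₁ ^ 2) 0]
  · have : max (m₂ - m₁ ^ 2) 0 ≤ M.var s a v₀ + 4 := max_le (by linarith) (by linarith)
    linarith

/-- Since |y - Var| ≤ 4, y + 4 is a legitimate variance bound and y + 1 ≤ Var + 5 controls the
accuracy. Subtracting the error radius makes the estimate one-sided at the price of doubling the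
error; three calls cost 3f. -/
theorem failsLE_anchor (hO : O.IsGenerativeModel M) {ε f : ℝ} (hε : 0 < ε)
    (hεΓ : ε ≤ √(horizon M.γ)) (hf : 0 < f) {v₀ : S → ℝ} (hv0 : ∀ s, 0 ≤ v₀ s)
    (hvΓ : ∀ s, v₀ s ≤ horizon M.γ) (s : S) (a : A) :
    FailsLE (anchor O M.γ ε f v₀ s a)
      (fun x => M.mean s a v₀ - 2 * (paramC * (1 - M.γ) ^ (3 / 2 : ℝ) * ε *
        √(M.var s a v₀ + 5)) ≤ x ∧ x ≤ M.mean s a v₀) (3 * ENNReal.ofReal f) := by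
  have hΓ := M.horizon_pos
  have hc := M.accuracy_pos hε
  have hc1 := M.accuracy_lt_one hεΓ
  have hb : paramB = 1 := rfl
  rw [show (3 : ENNReal) * ENNReal.ofReal f =
    ENNReal.ofReal f + (ENNReal.ofReal f + ENNReal.ofReal f) by ring, anchor]
  refine (failsLE_qEst1 hO s a (pow_pos hΓ 2) (hb ▸ one_pos) hf (fun _ => sq_nonneg _)
    fun s' => pow_le_pow_left₀ (hv0 s') (hvΓ s') 2).bind fun m₂ hm₂ => ?_
  refine (failsLE_qEst1 hO s a hΓ (mul_pos M.one_sub_γ_pos (hb ▸ one_pos)) hf hv0 hvΓ).bind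
    fun m₁ hm₁ => failsLE_map.2 ?_
  rw [hb] at hm₂ hm₁
  rw [mul_one] at hm₁
  have hyV := abs_le.1 (abs_max_sub_var_le hv0 hvΓ hm₂ hm₁)
  have hy0 : 0 ≤ max (m₂ - m₁ ^ 2) 0 := le_max_right _ _
  generalize max (m₂ - m₁ ^ 2) 0 = y at hyV hy0 ⊢
  generalize paramC * (1 - M.γ) ^ (3 / 2 : ℝ) * ε = c at hc hc1 ⊢
  rw [hb, mul_one]
  have h2 : 0 < √(y + 1) := Real.sqrt_pos.2 (by linarith)
  have heσ : c * √(y + 1) < 4 * √(y + 4) := by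
    have h1 : √(y + 1) ≤ √(y + 4) := Real.sqrt_le_sqrt (by linarith)
    nlinarith
  refine (failsLE_qEst2 hO s a (mul_pos hc h2) heσ hf ?_).mono (fun m hm => ?_) le_rfl
  · rw [Real.sq_sqrt (by linarith)]
    change M.var s a v₀ ≤ y + 4
    linarith
  · have h1 : c * √(y + 1) ≤ c * √(M.var s a v₀ + 5) :=
      mul_le_mul_of_nonneg_left (Real.sqrt_le_sqrt (by linarith)) hc.le
    rw [abs_le] at hm
    constructor <;> linarith

/-- The invariant of the algorithm: `v` is a subsolution of the Bellman equation of the policy `π`,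
and `q` is at most the one-step lookahead of `v`. -/
structure Sol.Valid (M : MDP S A) (X : Sol S A) : Prop where
  v_nonneg : ∀ s, 0 ≤ X.v s
  v_le : ∀ s, X.v s ≤ M.r s (X.π s) + M.γ * M.mean s (X.π s) X.v
  q_le : ∀ s a, X.q s a ≤ M.r s a + M.γ * M.mean s a X.v

omit [DecidableEq S] [DecidableEq A] in
theorem Sol.Valid.v_le_value {X : Sol S A} (hX : X.Valid M) (s : S) : X.v s ≤ M.value X.π s :=
  M.le_value hX.v_le s

omit [DecidableEq S] [DecidableEq A] in
theorem Sol.Valid.q_le_qValue {X : Sol S A} (hX : X.Valid M) (s : S) (a : A) :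
    X.q s a ≤ M.qValue X.π s a := by
  rw [M.qValue_bellman]
  have := mul_le_mul_of_nonneg_left
    (MDP.mean_mono (M := M) (s := s) (a := a) hX.v_le_value) M.γ_nonneg
  linarith [hX.q_le s a]

omit [DecidableEq S] [DecidableEq A] in
theorem Sol.Valid.v_le_optValue {X : Sol S A} (hX : X.Valid M) (s : S) : X.v s ≤ M.optValue s :=
  (hX.v_le_value s).trans (M.value_le_optValue _ s)

variable [Nonempty A]

/-- The values after the greedy update of an iteration. -/
def Sol.nextV (X : Sol S A) (s : S) : ℝ :=
  if X.v s ≤ greedyValue X.q s then greedyValue X.q s else X.v s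

/-- The policy after the greedy update of an iteration. -/
def Sol.nextπ (X : Sol S A) (s : S) : A :=
  if X.v s ≤ greedyValue X.q s then argmax (X.q s) else X.π s

omit [Fintype S] [DecidableEq S] [DecidableEq A] in
theorem Sol.le_nextV (X : Sol S A) (s : S) : X.v s ≤ X.nextV s := by
  unfold Sol.nextV
  split_ifs with h
  · exact h
  · exact le_rfl

omit [Fintype S] [DecidableEq S] [DecidableEq A] in
theorem Sol.q_le_nextV (X : Sol S A) (s : S) (a : A) : X.q s a ≤ X.nextV s := by
  have h1 : X.q s a ≤ greedyValue X.q s := Classical.choose_spec (Finite.exists_max (X.q s)) a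
  unfold Sol.nextV
  split_ifs with h
  · exact h1
  · exact h1.trans (not_le.1 h).le

omit [DecidableEq S] [DecidableEq A] in
-- Where the greedy choice wins, the new value is some q[s, a] ≤ r + γPv; elsewhere the old
-- inequality is kept. Since values only increase, replacing v by the new values preserves both.
theorem Sol.Valid.next {X : Sol S A} (hX : X.Valid M) (s : S) :
    X.nextV s ≤ M.r s (X.nextπ s) + M.γ * M.mean s (X.nextπ s) X.nextV := by
  have hmono : ∀ a, M.γ * M.mean s a X.v ≤ M.γ * M.mean s a X.nextV := fun a =>
    mul_le_mul_of_nonneg_left (MDP.mean_mono X.le_nextV) M.γ_nonneg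
  by_cases h : X.v s ≤ greedyValue X.q s
  · have h1 : X.nextV s = X.q s (X.nextπ s) := by
      simp only [Sol.nextV, Sol.nextπ, h, if_true]
      rfl
    rw [h1]
    exact (hX.q_le s _).trans (by linarith [hmono (X.nextπ s)])
  · have h1 : X.nextV s = X.v s := if_neg h
    have h2 : X.nextπ s = X.π s := if_neg h
    rw [h1, h2]
    exact (hX.v_le s).trans (by linarith [hmono (X.π s)])

/-- The state of an epoch after `l` iterations. -/
structure EpochInvariant (M : MDP S A) (v₀ : S → ℝ) (B : ℝ) (σ : S → A) (H : S → A → ℝ) (l : ℕ)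
    (X : Sol S A) : Prop where
  valid : X.Valid M
  le_v : ∀ s, v₀ s ≤ X.v s
  q_close : ∀ s a, M.optQValue s a - X.q s a ≤ M.γ ^ l * B + H s a
  v_close : l ≠ 0 → ∀ s, M.optValue s - X.v s ≤ M.γ ^ (l - 1) * B + H s (σ s)

/-- Upper bounds on x + Δ preserve validity. Lower bounds give q* - q ≤ γP(v* - v) plus γ times the
step error, and v* - v ≤ γ^l B + H(·, σ) by the greedy update; the inequality for H absorbs the
rest. -/
theorem failsLE_iteration (hO : O.IsGenerativeModel M) {f : ℝ} (hf : 0 < f) {k : ℕ} {v₀ : S → ℝ}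
    {x : S × A → ℝ} {σ : S → A} (hσ : ∀ s, M.optValue s ≤ M.optQValue s (σ s))
    {H ξ : S → A → ℝ} (hH : ∀ s a, M.γ * (ξ s a + paramC * (1 - M.γ) * epochError M.γ k) +
      M.γ * M.mean s a (fun s' => H s' (σ s')) ≤ H s a)
    (hx : ∀ s a, M.mean s a v₀ - ξ s a ≤ x (s, a) ∧ x (s, a) ≤ M.mean s a v₀)
    (hv₀ : ∀ s, M.optValue s - v₀ s ≤ epochError M.γ k) {l : ℕ} {X : Sol S A}
    (hX : EpochInvariant M v₀ (epochError M.γ k) σ H l X) :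
    FailsLE (iteration M.r M.γ O f (k + 1) v₀ x X)
      (EpochInvariant M v₀ (epochError M.γ k) σ H (l + 1))
      (Fintype.card (S × A) * ENNReal.ofReal f) := by
  have hB := M.epochError_pos k
  have hB1 := M.epochError_pos (k + 1)
  have hBk := epochError_eq_two_mul M.γ k
  have hγ := M.one_sub_γ_pos
  set B := epochError M.γ k
  set B' := epochError M.γ (k + 1)
  have hnext : ∀ s, X.nextV s ≤ M.optValue s := fun s =>
    (M.le_value (π := X.nextπ) hX.valid.next s).trans (M.value_le_optValue _ s)
  have hvnext : ∀ s, M.optValue s - X.nextV s ≤ M.γ ^ l * B + H s (σ s) := fun s => by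
    linarith [hσ s, hX.q_close s (σ s), X.q_le_nextV s (σ s)]
  have he : 0 < paramC * (1 - M.γ) * B' := mul_pos (mul_pos (by norm_num [paramC]) hγ) hB1
  have hest : ∀ sa : S × A, FailsLE ((qEst1 O sa.1 sa.2 (fun s' => X.nextV s' - v₀ s') (2 * B')
      (paramC * (1 - M.γ) * B') f).map fun m => m - paramC * (1 - M.γ) * B')
      (fun Δ => M.mean sa.1 sa.2 X.nextV - M.mean sa.1 sa.2 v₀ - paramC * (1 - M.γ) * B ≤ Δ ∧
        Δ ≤ M.mean sa.1 sa.2 X.nextV - M.mean sa.1 sa.2 v₀) (ENNReal.ofReal f) := by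
    intro sa
    refine failsLE_map.2 ((failsLE_qEst1 hO sa.1 sa.2 (by positivity) he hf (fun s' => ?_)
      fun s' => ?_).mono (fun m hm => ?_) le_rfl)
    · linarith [hX.le_v s', X.le_nextV s']
    -- Epoch k + 1 works with B' = B/2, so the range 2B' is B, which bounds v* - v₀ and hence the
    -- increment of the values. The shifted estimate loses 2c(1-γ)B' = c(1-γ)B.
    · linarith [hnext s', hv₀ s']
    · rw [MDP.mean_sub, abs_le] at hm
      have : paramC * (1 - M.γ) * B = 2 * (paramC * (1 - M.γ) * B') := by
        rw [hBk]
        ring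
      constructor <;> linarith
  refine failsLE_map.2 ((failsLE_indep hest).mono (fun Δ hΔ => ?_) le_rfl)
  refine ⟨⟨fun s => (hX.valid.v_nonneg s).trans (X.le_nextV s), hX.valid.next, fun s a => ?_⟩,
    fun s => (hX.le_v s).trans (X.le_nextV s), fun s a => ?_, fun _ s => ?_⟩
  · have h0 : 0 ≤ M.mean s a X.nextV :=
      MDP.mean_nonneg fun s' => (hX.valid.v_nonneg s').trans (X.le_nextV s')
    -- Truncating q at 0 is safe because the lookahead r + γPv is nonnegative.
    refine max_le ?_ (add_nonneg (M.r_nonneg s a) (mul_nonneg M.γ_nonneg h0))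
    have h1 : x (s, a) + Δ (s, a) ≤ M.mean s a X.nextV := by
      have := (hΔ (s, a)).2
      simp only at this
      linarith [(hx s a).2]
    have := mul_le_mul_of_nonneg_left h1 M.γ_nonneg
    change _ ≤ M.r s a + M.γ * M.mean s a X.nextV
    linarith
  · have h1 : M.mean s a X.nextV - (ξ s a + paramC * (1 - M.γ) * B) ≤ x (s, a) + Δ (s, a) := by
      have := (hΔ (s, a)).1
      simp only at this
      linarith [(hx s a).1]
    have h2 := mul_le_mul_of_nonneg_left h1 M.γ_nonneg
    have h3 : M.mean s a M.optValue - M.mean s a X.nextV ≤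
        M.γ ^ l * B + M.mean s a (fun s' => H s' (σ s')) := by
      rw [← MDP.mean_sub, ← M.mean_const s a (M.γ ^ l * B), ← MDP.mean_add]
      exact MDP.mean_mono hvnext
    have h4 := mul_le_mul_of_nonneg_left h3 M.γ_nonneg
    have h5 := M.optQValue_le s a
    have h6 : M.r s a + M.γ * (x (s, a) + Δ (s, a)) ≤
      max (M.r s a + M.γ * (x (s, a) + Δ (s, a))) 0 := le_max_left _ _
    have h7 := hH s a
    change M.optQValue s a - max (M.r s a + M.γ * (x (s, a) + Δ (s, a))) 0 ≤ _
    rw [pow_succ']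
    linarith
  · exact hvnext s

/-- The state of the algorithm with accuracy `B`. -/
structure Sol.Accurate (M : MDP S A) (B : ℝ) (X : Sol S A) : Prop where
  valid : X.Valid M
  v_close : ∀ s, M.optValue s - X.v s ≤ B
  q_close : ∀ s a, M.optQValue s a - X.q s a ≤ B

/-- At the end γ^{L-1}B ≤ B/4 and H ≤ B/4, so the error is halved. The failure budget counts three
calls per pair for the anchor and one per pair in each iteration. -/
theorem failsLE_epoch (hO : O.IsGenerativeModel M) {ε f : ℝ} (hε : 0 < ε)
    (hεΓ : ε ≤ √(horizon M.γ)) (hf : 0 < f) {k : ℕ} (hk : k < numEpochs M.γ ε) {X : Sol S A}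
    (hX : X.Accurate M (epochError M.γ k)) :
    FailsLE (epoch M.r M.γ O ε f (k + 1) X) (Sol.Accurate M (epochError M.γ (k + 1)))
      (Fintype.card (S × A) * (3 * ENNReal.ofReal f) +
        epochLength M.γ ε * (Fintype.card (S × A) * ENNReal.ofReal f)) := by
  obtain ⟨σ, hσ⟩ := M.exists_optValue_le
  have hB := M.epochError_pos k
  obtain ⟨H, hH0, hH4, hH⟩ := M.exists_error_potential hε hεΓ (M.le_epochError hε hk) hσ
  have hclose : ∀ s, |X.v s - M.optValue s| ≤ epochError M.γ k := fun s => by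
    rw [abs_sub_comm, abs_of_nonneg (sub_nonneg.2 (hX.valid.v_le_optValue s))]
    exact hX.v_close s
  have hanchor := failsLE_indep fun sa : S × A => failsLE_anchor hO hε hεΓ hf hX.valid.v_nonneg
    (fun s => (hX.valid.v_le_optValue s).trans (M.optValue_le_horizon s)) sa.1 sa.2
  refine hanchor.bind fun x hx => ?_
  have hloop := failsLE_loop (step := fun _ => iteration M.r M.γ O f (k + 1) X.v x)
    (I := EpochInvariant M X.v (epochError M.γ k) σ H) (X := X)
    (x := Fintype.card (S × A) * ENNReal.ofReal f) (n := epochLength M.γ ε)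
    ⟨hX.valid, fun s => le_rfl, fun s a => by
      rw [pow_zero, one_mul]
      linarith [hX.q_close s a, hH0 s a], fun h => absurd rfl h⟩
    fun l _ Y hY => failsLE_iteration hO hf hσ (hH X.v hclose) (fun s a => hx (s, a)) hX.v_close hY
  refine hloop.mono (fun Y hY => ?_) le_rfl
  have hpow := M.pow_epochLength_le hε hεΓ
  have hL : epochLength M.γ ε ≠ 0 := Nat.succ_ne_zero _
  have hpow' : M.γ ^ epochLength M.γ ε ≤ 1 / 4 :=
    (pow_le_pow_of_le_one M.γ_nonneg M.γ_lt_one.le (Nat.sub_le _ 1)).trans hpow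
  have hhalf := epochError_eq_two_mul M.γ k
  refine ⟨hY.valid, fun s => ?_, fun s a => ?_⟩
  · have h1 := hY.v_close hL s
    have h2 := mul_le_mul_of_nonneg_right hpow hB.le
    linarith [hH4 s (σ s)]
  · have h1 := hY.q_close s a
    have h2 := mul_le_mul_of_nonneg_right hpow' hB.le
    linarith [hH4 s a]

omit [DecidableEq S] [DecidableEq A] in
-- There are K·S·A·(3 + L) calls, and 3 + L ≤ 4L explains the 4 in f. If K = 0 no call is made, and
-- f is a junk division by zero.
theorem total_failProb_le [Nonempty S] {ε δ : ℝ} (hδ : 0 < δ) :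
    (numEpochs M.γ ε : ENNReal) *
      (Fintype.card (S × A) * (3 * ENNReal.ofReal (failProb S A M.γ ε δ)) +
        epochLength M.γ ε * (Fintype.card (S × A) * ENNReal.ofReal (failProb S A M.γ ε δ))) ≤
      ENNReal.ofReal δ := by
  rcases Nat.eq_zero_or_pos (numEpochs M.γ ε) with hK | hK
  · rw [hK, Nat.cast_zero, zero_mul]
    exact zero_le
  have hL : 1 ≤ epochLength M.γ ε := Nat.succ_le_succ (Nat.zero_le _)
  have hS : 0 < Fintype.card S := Fintype.card_pos
  have hA : 0 < Fintype.card A := Fintype.card_pos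
  have h1 : (numEpochs M.γ ε : ENNReal) *
      (Fintype.card (S × A) * (3 * ENNReal.ofReal (failProb S A M.γ ε δ)) +
        epochLength M.γ ε * (Fintype.card (S × A) * ENNReal.ofReal (failProb S A M.γ ε δ))) =
      ((numEpochs M.γ ε * (Fintype.card S * Fintype.card A) * (3 + epochLength M.γ ε) : ℕ) :
        ENNReal) * ENNReal.ofReal (failProb S A M.γ ε δ) := by
    rw [Fintype.card_prod]
    push_cast
    ring
  rw [h1, ← ENNReal.ofReal_natCast, ← ENNReal.ofReal_mul (Nat.cast_nonneg _)]
  refine ENNReal.ofReal_le_ofReal ?_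
  rw [failProb]
  have hK' : (0 : ℝ) < numEpochs M.γ ε := Nat.cast_pos.2 hK
  have hL' : (1 : ℝ) ≤ epochLength M.γ ε := Nat.one_le_cast.2 hL
  have hS' : (0 : ℝ) < Fintype.card S := Nat.cast_pos.2 hS
  have hA' : (0 : ℝ) < Fintype.card A := Nat.cast_pos.2 hA
  push_cast
  rw [mul_div_assoc', div_le_iff₀ (by positivity)]
  have h2 : (3 + epochLength M.γ ε : ℝ) ≤ 4 * epochLength M.γ ε := by linarith
  calc _ = (numEpochs M.γ ε * (Fintype.card S * Fintype.card A) * δ : ℝ) *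
        (3 + epochLength M.γ ε) := by ring
    _ ≤ (numEpochs M.γ ε * (Fintype.card S * Fintype.card A) * δ : ℝ) *
        (4 * epochLength M.γ ε) := mul_le_mul_of_nonneg_left h2 (by positivity)
    _ = _ := by ring

theorem failsLE_solveMdp1 (hO : O.IsGenerativeModel M) {ε δ : ℝ} (hε : 0 < ε)
    (hεΓ : ε ≤ √(horizon M.γ)) (hδ : 0 < δ) (π₀ : S → A) :
    FailsLE (solveMdp1 M.r M.γ O ε δ π₀) (Sol.Accurate M ε) (ENNReal.ofReal δ) := by
  have : Nonempty S := ⟨O.zero⟩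
  have hloop := failsLE_loop (step := epoch M.r M.γ O ε (failProb S A M.γ ε δ))
    (I := fun k => Sol.Accurate M (epochError M.γ k)) (X := ⟨fun _ => 0, π₀, fun _ _ => 0⟩)
    (n := numEpochs M.γ ε) (x := Fintype.card (S × A) *
      (3 * ENNReal.ofReal (failProb S A M.γ ε δ)) + epochLength M.γ ε *
        (Fintype.card (S × A) * ENNReal.ofReal (failProb S A M.γ ε δ))) ?_ ?_
  · refine hloop.mono (fun Y hY => ⟨hY.valid, fun s => ?_, fun s a => ?_⟩)
      (total_failProb_le hδ)
    · exact (hY.v_close s).trans (M.epochError_numEpochs_le hε)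
    · exact (hY.q_close s a).trans (M.epochError_numEpochs_le hε)
  -- The zero start is valid because rewards are nonnegative, and it has error at most Γ because v*
  -- and q* are at most Γ.
  · have h0 : epochError M.γ 0 = horizon M.γ := by simp [epochError]
    refine ⟨⟨fun _ => le_rfl, fun s => ?_, fun s a => ?_⟩, fun s => ?_, fun s a => ?_⟩
    · simp only
      rw [M.mean_const, mul_zero, add_zero]
      exact M.r_nonneg _ _
    · simp only
      rw [M.mean_const, mul_zero, add_zero]
      exact M.r_nonneg _ _
    · simp only [h0, sub_zero]
      exact M.optValue_le_horizon s
    · simp only [h0, sub_zero]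
      exact M.optQValue_le_horizon s a
  · intro k hk Y hY
    refine failsLE_epoch hO hε hεΓ ?_ hk hY
    -- Positivity of f needs K > 0, which any epoch index k < K supplies.
    have hK : 0 < numEpochs M.γ ε := Nat.zero_lt_of_lt hk
    have hL : 0 < epochLength M.γ ε := Nat.succ_pos _
    have hS : 0 < Fintype.card S := Fintype.card_pos
    have hA : 0 < Fintype.card A := Fintype.card_pos
    rw [failProb]
    positivity

end Algorithm

end

end QuantumMDP

open QuantumMDP
theorem mainTheorem1 {S A : Type*} [Fintype S] [DecidableEq S] [Fintype A] [DecidableEq A]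
    [Nonempty A] (M : MDP S A) (O : Oracle S A) (hO : O.IsGenerativeModel M)
    (ε δ : ℝ) (hε : 0 < ε) (hεΓ : ε ≤ √(horizon M.γ)) (hδ : 0 < δ) (hδ1 : δ < 1) (π₀ : S → A) :
    ENNReal.ofReal (1 - δ) ≤ (solveMdp1 M.r M.γ O ε δ π₀).toOuterMeasure
      {out | (∀ s, M.optValue s - ε ≤ out.v s ∧ out.v s ≤ M.value out.π s ∧
          M.value out.π s ≤ M.optValue s) ∧
        ∀ s a, M.optQValue s a - ε ≤ out.q s a ∧ out.q s a ≤ M.qValue out.π s a ∧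
          M.qValue out.π s a ≤ M.optQValue s a} := by
  refine ((failsLE_solveMdp1 hO hε hεΓ hδ π₀).mono (fun X hX => ?_) le_rfl).le_toOuterMeasure hδ.le
  exact ⟨fun s => ⟨by linarith [hX.v_close s], hX.valid.v_le_value s, M.value_le_optValue _ s⟩,
    fun s a => ⟨by linarith [hX.q_close s a], hX.valid.q_le_qValue s a,
      M.qValue_le_optQValue _ s a⟩⟩
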